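/- Let $\mathcal{H}$ be a finite-dimensional Hilbert space, let $n\in\mathbb{N}$, and let $\rho$ be a density operator on $\mathcal{H}^{\otimes n}=\mathcal{H}_1\otimes\cdots\otimes\mathcal{H}_n$. Let $\mathcal{F}=\{F_z\}_{z\in\mathcal{Z}}$ be a POVM on $\mathcal{H}$ with finite outcome set $\mathcal{Z}$, and let $\bar{\mathcal{F}}=\{|z\rangle\langle z|\}_{z\in\bar{\mathcal{Z}}}$ be the POVM given by an orthonormal basis of $\mathcal{H}$. Let $0<p<1$ and $\varepsilon>0$. All logarithms are binary. Notation. $\mathcal{S}(\mathcal{H})$ is the set of density operators on $\mathcal{H}$. For a POVM $\mathcal{G}$, $\gamma_{\mathcal{G}}(\sigma)$ is the distribution $z\mapsto\mathrm{tr}(G_z\sigma)$ of outcomes, and $\gamma_{\mathcal{G}}^{-1}(\mathcal{P})=\{\sigma\in\mathcal{S}(\mathcal{H}):\gamma_{\mathcal{G}}(\sigma)\in\mathcal{P}\}$. Distances are $\delta(P,Q)=\frac12\sum_z|P(z)-Q(z)|$ for distributions and $\delta(\rho,\sigma)=\frac12\mathrm{tr}|\rho-\sigma|$ for density operators; $\mathcal{B}^{\eta}(\cdot)$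 is the closed $\eta$-environment of a point or of a set (the union of the environments of its points), among distributions or density operators. $H$ is the Shannon entropy and $H^{\max}(\mathcal{W})=\sup_{P\in\mathcal{W}}H(P)$, with $H^{\max}(\emptyset)=0$. For $\mu\ge0$, $S_0^{\mu}(\sigma)=\min\{\log\mathrm{rank}(\sigma'):\sigma'\in\mathcal{B}^{\mu}(\sigma)\}$. The density range $\mathcal{R}$ of $\rho$ is the smallest convex subset of $\mathcal{S}(\mathcal{H})$ that contains, for every $k\in\{1,\dots,n\}$, every POVM on $\mathcal{H}_1\otimes\cdots\otimes\mathcal{H}_{k-1}$ and every outcome $z$ of nonzero probability, the state of $\mathcal{H}_k$ conditioned on the outcome $z$. Let $A\subseteq\{1,\dots,n\}$ be a $p$-random selection (each index is chosen independently with probability $p$). Let $\mathbf{Z}_A$ be the $|A|$-tuple of outcomes when the factors $\mathcal{H}_i$, $i\in A$, of $\rho$ are measured with $\mathcal{F}$, let $Q_{\mathbf{Z}_A}$ be its frequency distribution (for the empty tuple, where it is otherwise undefined, $Q_{\mathbf{Z}_\emptyset}$ is an arbitrary fixed probability distribution $Q_0$ on $\mathcal{Z}$), and let $\rho_{\bar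 A}$ be the remaining state of the factors in the complement $\bar A$. Then there exists a function $\mu\ge0$ with \[ E[\mu(Q_{\mathbf{Z}_A},A)]\;\le\;2^{\frac{\dim(\mathcal{H})+|\mathcal{Z}|}{2}}\,e^{-\frac{n\varepsilon^2}{16}} \] such that, for every probability distribution $\hat Q$ on $\mathcal{Z}$ and every $a\subseteq\{1,\dots,n\}$ for which the event $Q_{\mathbf{Z}_A}=\hat Q,\ A=a$ has positive probability, \[ S_0^{\mu(\hat Q,a)}\bigl(\rho_{\bar A}\,\big|\,Q_{\mathbf{Z}_A}=\hat Q,\,A=a\bigr)\;\le\;|\bar a|\,H^{\max}(\mathcal{B}(\hat Q))+\log(|\bar a|)\,(\dim(\mathcal{H})-1), \] where $\mathcal{B}(\hat Q)=\mathcal{B}^{\varepsilon/(1-p)}\bigl(\gamma_{\bar{\mathcal{F}}}(\mathcal{R}\cap\gamma_{\mathcal{F}}^{-1}(\mathcal{B}^{\varepsilon/p}(\hat Q)))\bigr)$ and, for $\bar a=\emptyset$, $\log 0$ is read as $0$. -/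

import Mathlib

open scoped MatrixOrder ComplexOrder

noncomputable section

namespace QuantEntr

/-! The Hilbert space of dimension `|ι|` with a fixed orthonormal basis is `ℂ^ι`; its operators are
`ι × ι` matrices. The tensor product of the factors `i ∈ s`, each equal to `ℂ^ι`, is
`ℂ^(s → ι)`, and the `n`-fold product is `ℂ^(Fin n → ι)`. -/

/-! ### Classical probability -/

/-- Probability distributions on a finite set. -/
def IsProb {Z : Type*} [Fintype Z] (P : Z → ℝ) : Prop :=
  (∀ z, 0 ≤ P z) ∧ ∑ z, P z = 1

/-- Variational distance. -/
def varDist {Z : Type*} [Fintype Z] (P Q : Z → ℝ) : ℝ :=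
  (1 / 2) * ∑ z, |P z - Q z|

/-- The `η`-environment (in the set of probability distributions) of a set `W`. -/
def probBall {Z : Type*} [Fintype Z] (η : ℝ) (W : Set (Z → ℝ)) : Set (Z → ℝ) :=
  {P | IsProb P ∧ ∃ Q ∈ W, varDist Q P ≤ η}

/-- Shannon entropy with binary logarithm (`0 log 0 = 0`). -/
def shannon {Z : Type*} [Fintype Z] (P : Z → ℝ) : ℝ :=
  -∑ z, P z * Real.logb 2 (P z)

/-- Maximal (supremal) Shannon entropy over a set of distributions; it is `0` on the empty set. -/
def shannonMax {Z : Type*} [Fintype Z] (W : Set (Z → ℝ)) : ℝ :=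
  sSup (shannon '' W)

/-- Frequency distribution of a tuple. The quotient `0 / 0` for the empty tuple is replaced by
a prescribed distribution `Q₀`. -/
def freq {Z κ : Type*} [DecidableEq Z] [Fintype κ] (Q₀ : Z → ℝ) (z : κ → Z) : Z → ℝ :=
  if Fintype.card κ = 0 then Q₀
  else fun x => ((Finset.univ.filter fun i => z i = x).card : ℝ) / (Fintype.card κ : ℝ)

/-- Law of a `p`-random selection on `{1, …, n}`. -/
def selProb {n : ℕ} (p : ℝ) (a : Finset (Fin n)) : ℝ :=
  ∏ i, if i ∈ a then p else 1 - p

/-! ### Quantum states and measurements -/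

/-- Density operators. -/
def IsDensity {κ : Type*} [Fintype κ] (ρ : Matrix κ κ ℂ) : Prop :=
  ρ.PosSemidef ∧ ρ.trace = 1

/-- Trace distance `½ tr |ρ - σ|`. -/
def traceDist {κ : Type*} [Fintype κ] [DecidableEq κ] (ρ σ : Matrix κ κ ℂ) : ℝ :=
  (1 / 2) * (CFC.abs (ρ - σ)).trace.re

/-- `ε`-smooth Rényi entropy of order `0`: the minimum of `log (rank σ)` over the density
operators `σ` in the `ε`-environment of `ρ`. -/
def smoothS0 {κ : Type*} [Fintype κ] [DecidableEq κ] (ε : ℝ) (ρ : Matrix κ κ ℂ) : ℝ :=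
  sInf ((fun σ : Matrix κ κ ℂ => Real.logb 2 (σ.rank : ℝ)) ''
    {σ | IsDensity σ ∧ traceDist ρ σ ≤ ε})

/-- Positive operator valued measures on `ℂ^κ` with outcomes in `Z`. -/
structure POVM (Z κ : Type*) [Fintype Z] [Fintype κ] [DecidableEq κ] where
  op : Z → Matrix κ κ ℂ
  pos : ∀ z, (op z).PosSemidef
  sum_eq : ∑ z, op z = 1

/-- `F` is the measurement in some orthonormal basis. -/
def POVM.IsOrthogonal {Z κ : Type*} [Fintype Z] [Fintype κ] [DecidableEq κ]
    (F : POVM Z κ) : Prop :=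
  ∃ b : OrthonormalBasis Z ℂ (EuclideanSpace ℂ κ),
    ∀ z, F.op z = Matrix.of fun i j => b z i * star (b z j)

/-- Measurement mapping `ρ ↦ (z ↦ tr (F_z ρ))`. -/
def POVM.meas {Z κ : Type*} [Fintype Z] [Fintype κ] [DecidableEq κ]
    (F : POVM Z κ) (ρ : Matrix κ κ ℂ) : Z → ℝ :=
  fun z => (F.op z * ρ).trace.re

/-- Density operators whose outcome distribution lies in `W`. -/
def POVM.measInv {Z κ : Type*} [Fintype Z] [Fintype κ] [DecidableEq κ]
    (F : POVM Z κ) (W : Set (Z → ℝ)) : Set (Matrix κ κ ℂ) :=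
  {ρ | IsDensity ρ ∧ F.meas ρ ∈ W}

/-! ### Multipartite systems -/

section Multi

variable {n : ℕ} {ι : Type*}

/-- The basis index of the whole system with parts `x` on `s` and `w` on the complement. -/
def glue (s : Finset (Fin n)) (x : {i // i ∈ s} → ι) (w : {i // i ∉ s} → ι) : Fin n → ι :=
  fun i => if h : i ∈ s then x ⟨i, h⟩ else w ⟨i, h⟩

/-- Partial trace over all factors outside `s`. -/
def reduce [Fintype ι] (s : Finset (Fin n)) (M : Matrix (Fin n → ι) (Fin n → ι) ℂ) :
    Matrix ({i // i ∈ s} → ι) ({i // i ∈ s} → ι) ℂ :=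
  Matrix.of fun x y => ∑ w : {i // i ∉ s} → ι, M (glue s x w) (glue s y w)

/-- `E ⊗ id`: an operator on the factors in `s` seen as an operator on the whole system. -/
def embed [DecidableEq ι] (s : Finset (Fin n))
    (E : Matrix ({i // i ∈ s} → ι) ({i // i ∈ s} → ι) ℂ) :
    Matrix (Fin n → ι) (Fin n → ι) ℂ :=
  Matrix.of fun x y =>
    if ∀ i, i ∉ s → x i = y i then E (fun i => x i) (fun i => y i) else 0

/-- `⊗_{i ∈ s} F_{z_i}`. -/
def prodOp {Z : Type*} [Fintype Z] [Fintype ι] [DecidableEq ι] (F : POVM Z ι)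
    (s : Finset (Fin n)) (z : {i // i ∈ s} → Z) :
    Matrix ({i // i ∈ s} → ι) ({i // i ∈ s} → ι) ℂ :=
  Matrix.of fun x y => ∏ i, F.op (z i) (x i) (y i)

/-- The operator `tr ((E ⊗ id) ρ)` on the `k`-th factor, before normalization, for an operator `E`
on the factors preceding `k`. -/
def siteOp [Fintype ι] [DecidableEq ι] (ρ : Matrix (Fin n → ι) (Fin n → ι) ℂ) (k : Fin n)
    (E : Matrix ({i // i ∈ Finset.Iio k} → ι) ({i // i ∈ Finset.Iio k} → ι) ℂ) :
    Matrix ι ι ℂ :=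
  Matrix.of fun i j => reduce {k} (embed (Finset.Iio k) E * ρ) (fun _ => i) (fun _ => j)

/-- Density range: the smallest convex set containing, for all `k`, all (finite) POVMs on the
factors preceding `k` and all outcomes `z` of nonzero probability, the state of the `k`-th factor
conditioned on `z`. -/
def densityRange [Fintype ι] [DecidableEq ι] (ρ : Matrix (Fin n → ι) (Fin n → ι) ℂ) :
    Set (Matrix ι ι ℂ) :=
  convexHull ℝ {τ | ∃ (k : Fin n) (m : ℕ) (G : POVM (Fin m) ({i // i ∈ Finset.Iio k} → ι))
    (z : Fin m), (siteOp ρ k (G.op z)).trace ≠ 0 ∧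
      τ = (siteOp ρ k (G.op z)).trace⁻¹ • siteOp ρ k (G.op z)}

variable {Z : Type*} [Fintype Z] [Fintype ι] [DecidableEq ι]

/-- Probability of the outcome tuple `z` when the factors in `a` are measured with `F`. -/
def outcomeProb (F : POVM Z ι) (ρ : Matrix (Fin n → ι) (Fin n → ι) ℂ)
    (a : Finset (Fin n)) (z : {i // i ∈ a} → Z) : ℝ :=
  (embed a (prodOp F a z) * ρ).trace.re

open Classical in
/-- Probability that the observed frequency distribution is `Q`, given that the factors in `a`
are measured. -/
def freqProb (F : POVM Z ι) (ρ : Matrix (Fin n → ι) (Fin n → ι) ℂ) (Q₀ : Z → ℝ)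
    (Q : Z → ℝ) (a : Finset (Fin n)) : ℝ :=
  ∑ z : {i // i ∈ a} → Z, if freq Q₀ z = Q then outcomeProb F ρ a z else 0

open Classical in
/-- State of the factors outside `a`, given that the factors in `a` are measured and that the
observed frequency distribution is `Q`. -/
def condState (F : POVM Z ι) (ρ : Matrix (Fin n → ι) (Fin n → ι) ℂ) (Q₀ : Z → ℝ)
    (Q : Z → ℝ) (a : Finset (Fin n)) :
    Matrix ({i // i ∈ aᶜ} → ι) ({i // i ∈ aᶜ} → ι) ℂ :=
  (freqProb F ρ Q₀ Q a)⁻¹ •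
    ∑ z : {i // i ∈ a} → Z,
      if freq Q₀ z = Q then reduce aᶜ (embed a (prodOp F a z) * ρ) else 0

open Classical in
/-- Expectation of `μ (Q_{Z_A}, A)` for a `p`-random selection `A`. -/
def expect (F : POVM Z ι) (ρ : Matrix (Fin n → ι) (Fin n → ι) ℂ) (Q₀ : Z → ℝ) (p : ℝ)
    (μ : (Z → ℝ) → Finset (Fin n) → ℝ) : ℝ :=
  ∑ a : Finset (Fin n), selProb p a *
    ∑ z : {i // i ∈ a} → Z, outcomeProb F ρ a z * μ (freq Q₀ z) a

/-- `𝓑(Q) = B^{ε/(1-p)} (γ_F' (𝓡 ∩ γ_F⁻¹ (B^{ε/p} (Q))))`. -/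
def compatible {Z' : Type*} [Fintype Z'] (F : POVM Z ι) (F' : POVM Z' ι)
    (R : Set (Matrix ι ι ℂ)) (p ε : ℝ) (Q : Z → ℝ) : Set (Z' → ℝ) :=
  probBall (ε / (1 - p)) (F'.meas '' (R ∩ F.measInv (probBall (ε / p) {Q})))

end Multi

end QuantEntr

end

noncomputable section

namespace QuantEntr

set_option linter.unusedSectionVars false

open Matrix

/-! ### Positivity and the trace pairing -/

section General

variable {κ : Type*} [Fintype κ]

/-! Imagine that the factors outside `a` are also measured, with `F'`. Choosing each factor with
probability `p` for `F` and otherwise using `F'` is one product measurement `G = pF ⊕ (1-p)F'`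
(`mixPOVM`), whose outcome string reveals both the selection and the two outcome tuples
(`selProb_mul_jointProb`, `glueOutcomes_injective`).

Read the string from left to right. The state of factor `k` given the earlier outcomes lies in the
density range, hence so does its average over `k` (`avgState`). The number of outcomes in a set `T`
minus the sum of their conditional probabilities is a martingale, so Hoeffding's exponential bound
applies (`martingale_mgf_le`, `sum_deviation_tail_le`). Outside the resulting tail events, one and
the same average state explains the observed frequencies on `a` up to `ε/p` and the virtual
frequencies on the complement up to `ε/(1-p)` (`varDist_freq_le`). The virtual string then has a
type in `compatible`; the total failure probability is at most `2^(dim + |Z|) e^(-nε²/8)`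
(`sum_jointProb_compl_le`).

For `F'` orthogonal, the typical strings span a subspace with projection `P`. Projecting the
conditional state onto it moves it by at most the square root of the conditional failure probability
(`gentle_measurement`), and the rank becomes at most the number of typical strings. That square root
is `μ`; Jensen's inequality turns the failure bound into its square root, which is the stated
constant.

The set `compatible` is convex, so the typical strings can be counted through the entropy of their
average type (`logb_card_le_of_freq_mem`). This gives the entropy term alone; the logarithmic term
in the theorem is nonnegative slack. -/

theorem trace_mul_nonneg {A B : Matrix κ κ ℂ} (hA : A.PosSemidef) (hB : B.PosSemidef) :
    0 ≤ (A * B).trace := by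
  classical
  obtain ⟨C, rfl⟩ := CStarAlgebra.nonneg_iff_eq_star_mul_self.mp hA.nonneg
  rw [Matrix.mul_assoc, Matrix.trace_mul_comm]
  exact (hB.mul_mul_conjTranspose_same C).trace_nonneg

theorem ofReal_re_of_nonneg {z : ℂ} (h : 0 ≤ z) : ((z.re : ℝ) : ℂ) = z := by
  rw [Complex.nonneg_iff] at h
  apply Complex.ext <;> simp [← h.2]

/-- Rank-one `K` recover the quadratic form of `M`. With `trace_mul_reduce` this gives positivity of
partial traces by duality. -/
theorem posSemidef_of_trace_nonneg {M : Matrix κ κ ℂ}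
    (h : ∀ K : Matrix κ κ ℂ, K.PosSemidef → 0 ≤ (K * M).trace) : M.PosSemidef := by
  classical
  rw [← Matrix.isPositive_toEuclideanLin_iff, LinearMap.isPositive_iff_complex]
  intro x
  have h1 := h _ (Matrix.posSemidef_vecMulVec_self_star x.ofLp)
  have h2 : (vecMulVec x.ofLp (star x.ofLp) * M).trace =
      inner ℂ x (Matrix.toEuclideanLin M x) := by
    rw [Matrix.vecMulVec_mul, Matrix.trace_vecMulVec, dotProduct_comm,
      ← Matrix.dotProduct_mulVec, dotProduct_comm]
    simp [EuclideanSpace.inner_eq_star_dotProduct, Matrix.toLpLin_apply]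
  rw [h2] at h1
  have h3 : 0 ≤ inner ℂ (Matrix.toEuclideanLin M x) x := by
    rw [← inner_conj_symm]
    exact star_nonneg_iff.mpr h1
  exact ⟨ofReal_re_of_nonneg h3, (Complex.nonneg_iff.mp h3).1⟩

end General

/-! ### Tensor products of operators -/

section Tensor

variable {κ ι : Type*} [Fintype κ] [Fintype ι]

/-- The tensor product of operators. -/
def tens (B : κ → Matrix ι ι ℂ) : Matrix (κ → ι) (κ → ι) ℂ :=
  Matrix.of fun x y => ∏ i, B i (x i) (y i)

variable [DecidableEq κ]

theorem tens_mul (B C : κ → Matrix ι ι ℂ) : tens B * tens C = tens fun i => B i * C i := by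
  ext x y
  simp only [tens, Matrix.mul_apply, Matrix.of_apply, ← Finset.prod_mul_distrib]
  rw [Finset.prod_univ_sum]
  simp

theorem tens_conjTranspose (B : κ → Matrix ι ι ℂ) : (tens B)ᴴ = tens fun i => (B i)ᴴ := by
  ext x y
  simp [tens, Matrix.conjTranspose_apply]

theorem tens_posSemidef {B : κ → Matrix ι ι ℂ} (h : ∀ i, (B i).PosSemidef) :
    (tens B).PosSemidef := by
  classical
  have := fun i => CStarAlgebra.nonneg_iff_eq_star_mul_self.mp (h i).nonneg
  choose C hC using this
  obtain rfl : B = fun i => (C i)ᴴ * C i := funext hC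
  rw [← tens_mul, ← tens_conjTranspose]
  exact posSemidef_conjTranspose_mul_self _

theorem tens_one [DecidableEq ι] : tens (fun _ : κ => (1 : Matrix ι ι ℂ)) = 1 := by
  ext x y
  simp only [tens, Matrix.of_apply, Matrix.one_apply, Finset.prod_ite_zero]
  simp [funext_iff]

theorem sum_tens {X : Type*} [Fintype X] (B : κ → X → Matrix ι ι ℂ) :
    ∑ w : κ → X, tens (fun i => B i (w i)) = tens fun i => ∑ x, B i x := by
  ext x y
  simp only [tens, Matrix.sum_apply, Matrix.of_apply]
  rw [Finset.prod_univ_sum]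
  simp

theorem tens_smul (c : κ → ℂ) (B : κ → Matrix ι ι ℂ) :
    tens (fun i => c i • B i) = (∏ i, c i) • tens B := by
  ext x y
  simp [tens, Finset.prod_mul_distrib]

/-- Linearity of the tensor product in one factor. -/
theorem sum_tens_update {X : Type*} (s : Finset X) (B : κ → Matrix ι ι ℂ)
    (k : κ) (C : X → Matrix ι ι ℂ) :
    ∑ x ∈ s, tens (Function.update B k (C x)) = tens (Function.update B k (∑ x ∈ s, C x)) := by
  ext x y
  simp only [tens, Matrix.sum_apply, Matrix.of_apply]
  simp only [← Finset.mul_prod_erase _ _ (Finset.mem_univ k), Function.update_self,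
    Matrix.sum_apply, Finset.sum_mul]
  refine Finset.sum_congr rfl fun z _ => ?_
  congr 1
  refine Finset.prod_congr rfl fun i hi => ?_
  simp [Function.update_of_ne (Finset.ne_of_mem_erase hi)]

end Tensor

/-! ### Operators on subsystems and partial traces -/

section Embed

variable {n : ℕ} {ι : Type*}

/-- Basis indices of the whole system are pairs of indices on `s` and off `s`. -/
def glueEquiv (s : Finset (Fin n)) (ι : Type*) :
    ({i // i ∈ s} → ι) × ({i // i ∉ s} → ι) ≃ (Fin n → ι) where
  toFun p := glue s p.1 p.2
  invFun x := (fun i => x i, fun i => x i)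
  left_inv p := by
    ext i <;> simp [glue, i.2]
  right_inv x := by
    ext i; simp [glue]

variable [Fintype ι] [DecidableEq ι]

theorem embed_eq_submatrix (s : Finset (Fin n))
    (E : Matrix ({i // i ∈ s} → ι) ({i // i ∈ s} → ι) ℂ) :
    embed s E = (E.kronecker (1 : Matrix ({i // i ∉ s} → ι) ({i // i ∉ s} → ι) ℂ)).submatrix
      (glueEquiv s ι).symm (glueEquiv s ι).symm := by
  ext x y
  simp [embed, glueEquiv, Matrix.kronecker, Matrix.one_apply, funext_iff]

theorem embed_posSemidef {s : Finset (Fin n)}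
    {E : Matrix ({i // i ∈ s} → ι) ({i // i ∈ s} → ι) ℂ} (h : E.PosSemidef) :
    (embed s E).PosSemidef := by
  rw [embed_eq_submatrix]
  exact (h.kronecker PosSemidef.one).submatrix _

theorem embed_sum {X : Type*} (t : Finset X) (s : Finset (Fin n))
    (E : X → Matrix ({i // i ∈ s} → ι) ({i // i ∈ s} → ι) ℂ) :
    embed s (∑ x ∈ t, E x) = ∑ x ∈ t, embed s (E x) := by
  ext x y
  simp only [embed, Matrix.of_apply, Matrix.sum_apply]
  split_ifs <;> simp

theorem embed_one (s : Finset (Fin n)) :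
    embed s (1 : Matrix ({i // i ∈ s} → ι) ({i // i ∈ s} → ι) ℂ) = 1 := by
  rw [embed_eq_submatrix]
  simp [Matrix.kronecker]

theorem embed_mul_embed_apply {s t : Finset (Fin n)} (hst : Disjoint s t)
    (E : Matrix ({i // i ∈ s} → ι) ({i // i ∈ s} → ι) ℂ)
    (K : Matrix ({i // i ∈ t} → ι) ({i // i ∈ t} → ι) ℂ) (x y : Fin n → ι) :
    (embed s E * embed t K) x y =
      if ∀ i, i ∉ s → i ∉ t → x i = y i then
        E (fun i => x i) (fun i => y i) * K (fun i => x i) (fun i => y i) else 0 := by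
  have hd : ∀ i, i ∈ s → i ∉ t := fun i hi => Finset.disjoint_left.mp hst hi
  -- The left factor fixes the intermediate index off `s` to be `x`; the right factor fixes it on
  -- `s`, which misses `t`, to be `y`. Only one index survives.
  rw [Matrix.mul_apply, Finset.sum_eq_single (glue s (fun i => y i) (fun i => x i))]
  · have h1 : (fun i : {i // i ∈ s} => glue s (fun i => y i) (fun i => x i) (i : Fin n)) =
        fun i => y i.1 := by ext i; simp [glue, i.2]
    have h2 : (fun i : {i // i ∈ t} => glue s (fun i => y i) (fun i => x i) (i : Fin n)) =
        fun i => x i.1 := by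
      ext i
      have : (i : Fin n) ∉ s := fun h => hd _ h i.2
      simp [glue, this]
    simp only [embed, Matrix.of_apply, h1, h2]
    rw [if_pos (fun i hi => by simp [glue, hi])]
    have : (∀ i, i ∉ t → glue s (fun i => y i) (fun i => x i) i = y i) ↔
        ∀ i, i ∉ s → i ∉ t → x i = y i := by
      refine forall_congr' fun i => ?_
      by_cases hi : i ∈ s <;> simp [glue, hi]
    simp only [this]
    split_ifs <;> simp
  · intro z _ hz
    unfold embed
    simp only [Matrix.of_apply]
    by_contra hne
    apply hz
    ext i
    by_cases h1 : ∀ i, i ∉ s → x i = z i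
    · by_cases h2 : ∀ i, i ∉ t → z i = y i
      · by_cases hi : i ∈ s
        · simpa [glue, hi] using h2 i (hd i hi)
        · simpa [glue, hi] using (h1 i hi).symm
      · simp [h2] at hne
    · simp [h1] at hne
  · simp

theorem commute_embed {s t : Finset (Fin n)} (hst : Disjoint s t)
    (E : Matrix ({i // i ∈ s} → ι) ({i // i ∈ s} → ι) ℂ)
    (K : Matrix ({i // i ∈ t} → ι) ({i // i ∈ t} → ι) ℂ) :
    Commute (embed s E) (embed t K) := by
  ext x y
  rw [embed_mul_embed_apply hst, embed_mul_embed_apply hst.symm]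
  have : (∀ i, i ∉ s → i ∉ t → x i = y i) ↔ ∀ i, i ∉ t → i ∉ s → x i = y i :=
    forall_congr' fun i => ⟨fun h a b => h b a, fun h a b => h b a⟩
  simp only [this, mul_comm]

/-- Operators on disjoint sets of factors commute, and commuting positive elements have a positive
product. -/
theorem embed_mul_embed_posSemidef {s t : Finset (Fin n)} (hst : Disjoint s t)
    {E : Matrix ({i // i ∈ s} → ι) ({i // i ∈ s} → ι) ℂ} (hE : E.PosSemidef)
    {K : Matrix ({i // i ∈ t} → ι) ({i // i ∈ t} → ι) ℂ} (hK : K.PosSemidef) :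
    (embed s E * embed t K).PosSemidef :=
  ((commute_embed hst E K).mul_nonneg (embed_posSemidef hE).nonneg
    (embed_posSemidef hK).nonneg).posSemidef

/-- Partial trace and embedding are adjoint for the trace pairing; every later computation with
reduced states goes through this. -/
theorem trace_mul_reduce (s : Finset (Fin n))
    (K : Matrix ({i // i ∈ s} → ι) ({i // i ∈ s} → ι) ℂ) (M : Matrix (Fin n → ι) (Fin n → ι) ℂ) :
    (K * reduce s M).trace = (embed s K * M).trace := by
  simp only [Matrix.trace, Matrix.diag_apply, Matrix.mul_apply]
  rw [← (glueEquiv s ι).sum_comp, Fintype.sum_prod_type]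
  refine Finset.sum_congr rfl fun x _ => ?_
  simp only [← (glueEquiv s ι).sum_comp (fun j => embed s K _ j * M j _), Fintype.sum_prod_type]
  rw [Finset.sum_comm]
  refine Finset.sum_congr rfl fun y _ => ?_
  simp only [reduce, Matrix.of_apply, Finset.mul_sum]
  refine Finset.sum_congr rfl fun w _ => ?_
  rw [Finset.sum_eq_single w]
  · simp only [embed_eq_submatrix, Matrix.submatrix_apply, Equiv.symm_apply_apply,
      Matrix.kronecker, Matrix.kroneckerMap_apply, Matrix.one_apply_eq, mul_one]
    rfl
  · intro v _ hv
    simp [embed_eq_submatrix, Matrix.kronecker, Matrix.one_apply_ne hv.symm]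
  · simp

theorem reduce_embed_mul_posSemidef {s t : Finset (Fin n)} (hst : Disjoint s t)
    {ρ : Matrix (Fin n → ι) (Fin n → ι) ℂ} (hρ : ρ.PosSemidef)
    {E : Matrix ({i // i ∈ s} → ι) ({i // i ∈ s} → ι) ℂ} (hE : E.PosSemidef) :
    (reduce t (embed s E * ρ)).PosSemidef := by
  refine posSemidef_of_trace_nonneg fun K hK => ?_
  rw [trace_mul_reduce, ← Matrix.mul_assoc]
  exact trace_mul_nonneg (embed_mul_embed_posSemidef hst.symm hK hE) hρ

theorem trace_reduce (s : Finset (Fin n)) (M : Matrix (Fin n → ι) (Fin n → ι) ℂ) :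
    (reduce s M).trace = M.trace := by
  simpa [embed_one] using trace_mul_reduce s 1 M

theorem embed_tens (s : Finset (Fin n)) (B : {i // i ∈ s} → Matrix ι ι ℂ) :
    embed s (tens B) = tens fun i => if h : i ∈ s then B ⟨i, h⟩ else 1 := by
  ext x y
  simp only [embed, tens, Matrix.of_apply]
  rw [← Finset.prod_mul_prod_compl s]
  have h1 : ∏ i ∈ s, (if h : i ∈ s then B ⟨i, h⟩ else 1) (x i) (y i) =
      ∏ i : {i // i ∈ s}, B i (x i) (y i) := by
    rw [← Finset.prod_coe_sort]
    exact Finset.prod_congr rfl fun i _ => by simp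
  have h2 : ∏ i ∈ sᶜ, (if h : i ∈ s then B ⟨i, h⟩ else 1) (x i) (y i) =
      if ∀ i, i ∉ s → x i = y i then 1 else 0 := by
    rw [Finset.prod_congr rfl (g := fun i => if x i = y i then (1 : ℂ) else 0)]
    · simp [Finset.prod_ite_zero]
    · intro i hi
      simp [Finset.mem_compl.mp hi, Matrix.one_apply]
  rw [h1, h2]
  split_ifs <;> simp

end Embed

/-! ### Trace distance and gentle measurement -/

section Gentle

variable {κ : Type*} [Fintype κ] [DecidableEq κ]

/-- A Hermitian matrix has a Hermitian unitary sign. -/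
theorem exists_sign_mul_eq_abs {A : Matrix κ κ ℂ} (hA : A.IsHermitian) :
    ∃ S : Matrix κ κ ℂ, S.IsHermitian ∧ S * S = 1 ∧ CFC.abs A = S * A := by
  have hsa : IsSelfAdjoint A := hA
  -- The value `1` at `0` makes `S` an involution even when `A` has a kernel; continuity is
  -- automatic on a finite spectrum.
  let f : ℝ → ℝ := fun x => if 0 ≤ x then 1 else -1
  have hf : ContinuousOn f (spectrum ℝ A) := (Matrix.finite_real_spectrum).continuousOn _
  refine ⟨cfc f A, cfc_predicate f A, ?_, ?_⟩
  · rw [← cfc_mul f f A hf hf, ← cfc_one ℝ A]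
    refine cfc_congr fun x _ => ?_
    simp only [f]
    split_ifs <;> simp
  · rw [CFC.abs_eq_cfc_norm A hsa]
    conv_rhs => rw [← cfc_id' ℝ A, cfc_id' ℝ A]
    nth_rewrite 3 [← cfc_id' ℝ A hsa]
    rw [← cfc_mul f _ A hf]
    refine cfc_congr fun x _ => ?_
    simp only [f, Real.norm_eq_abs]
    split_ifs with h
    · simp [abs_of_nonneg h]
    · simp [abs_of_neg (not_le.mp h)]

/-- Cauchy–Schwarz for the real Hilbert–Schmidt product: `tr (X - sY)(X - sY)ᴴ` is a nonnegative
quadratic in `s`, so its discriminant is at most `0`. -/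
theorem sq_re_trace_mul_conjTranspose_le (X Y : Matrix κ κ ℂ) :
    (X * Yᴴ).trace.re ^ 2 ≤ (X * Xᴴ).trace.re * (Y * Yᴴ).trace.re := by
  have key : ∀ s : ℝ, 0 ≤ (Y * Yᴴ).trace.re * (s * s) + (-2 * (X * Yᴴ).trace.re) * s +
      (X * Xᴴ).trace.re := by
    intro s
    have h := (posSemidef_self_mul_conjTranspose (X - (s : ℂ) • Y)).trace_nonneg
    have h1 : (Y * Xᴴ).trace.re = (X * Yᴴ).trace.re := by
      rw [← Matrix.conjTranspose_conjTranspose (Y * Xᴴ), Matrix.trace_conjTranspose]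
      simp
    have h2 := (Complex.nonneg_iff.mp h).1
    simp only [Matrix.conjTranspose_sub, Matrix.conjTranspose_smul, Matrix.sub_mul, Matrix.mul_sub,
      Matrix.trace_sub, Matrix.smul_mul, Matrix.mul_smul, Matrix.trace_smul] at h2
    simp [h1] at h2
    linarith
  have := discrim_le_zero key
  rw [discrim] at this
  linarith

/-- Trace distance of two density operators in terms of the overlap of roots. -/
theorem traceDist_mul_conjTranspose_le {C D : Matrix κ κ ℂ} (hC : (C * Cᴴ).trace.re = 1)
    (hD : (D * Dᴴ).trace.re = 1) :
    traceDist (C * Cᴴ) (D * Dᴴ) ≤ √(1 - (C * Dᴴ).trace.re ^ 2) := by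
  have hH : (C * Cᴴ - D * Dᴴ).IsHermitian :=
    (isHermitian_mul_conjTranspose_self C).sub (isHermitian_mul_conjTranspose_self D)
  obtain ⟨S, hS, hSS, habs⟩ := exists_sign_mul_eq_abs hH
  have h1 : (D * Cᴴ).trace.re = (C * Dᴴ).trace.re := by
    rw [← Matrix.conjTranspose_conjTranspose (D * Cᴴ), Matrix.trace_conjTranspose]
    simp
  -- Under the real trace with the Hermitian `S`, the cross terms of `(C - D)(C + D)ᴴ` cancel,
  -- leaving the trace norm. The two squared norms are `2 ∓ 2x`, with `x` the overlap, and their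
  -- product is `4(1 - x²)`.
  have hcs := sq_re_trace_mul_conjTranspose_le (S * (C - D)) (C + D)
  have hX : (S * (C - D) * (S * (C - D))ᴴ).trace.re = 2 - 2 * (C * Dᴴ).trace.re := by
    rw [Matrix.conjTranspose_mul, hS.eq, ← Matrix.mul_assoc, Matrix.trace_mul_comm,
      ← Matrix.mul_assoc, ← Matrix.mul_assoc, hSS, Matrix.one_mul]
    simp only [Matrix.conjTranspose_sub, Matrix.sub_mul, Matrix.mul_sub, Matrix.trace_sub,
      Complex.sub_re, hC, hD, h1]
    ring
  have hY : ((C + D) * (C + D)ᴴ).trace.re = 2 + 2 * (C * Dᴴ).trace.re := by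
    simp only [Matrix.conjTranspose_add, Matrix.add_mul, Matrix.mul_add, Matrix.trace_add,
      Complex.add_re, hC, hD, h1]
    ring
  have hXY : (S * (C - D) * (C + D)ᴴ).trace.re = (S * (C * Cᴴ - D * Dᴴ)).trace.re := by
    have h2 : (S * (D * Cᴴ)).trace.re = (S * (C * Dᴴ)).trace.re := by
      rw [← Matrix.conjTranspose_conjTranspose (S * (D * Cᴴ)), Matrix.trace_conjTranspose,
        Matrix.conjTranspose_mul, hS.eq, Matrix.trace_mul_comm]
      simp
    rw [Matrix.mul_assoc]
    simp only [Matrix.conjTranspose_add, Matrix.sub_mul, Matrix.mul_sub, Matrix.mul_add,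
      Matrix.trace_add, Matrix.trace_sub, Complex.add_re, Complex.sub_re, h2]
    ring
  rw [hX, hY, hXY] at hcs
  rw [traceDist, habs]
  refine Real.le_sqrt_of_sq_le ?_
  nlinarith

/-- The restriction of a density operator to the range of a projection of nonzero probability
is close to the original one. -/
theorem gentle_measurement {σ P : Matrix κ κ ℂ} (hσ : IsDensity σ) (hP : P.IsHermitian)
    (hPP : P * P = P) (ht : 0 < (P * σ).trace.re) :
    ∃ τ : Matrix κ κ ℂ, IsDensity τ ∧ τ.rank ≤ P.rank ∧
      traceDist σ τ ≤ √(1 - (P * σ).trace.re) := by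
  obtain ⟨B, hB⟩ := CStarAlgebra.nonneg_iff_eq_star_mul_self.mp hσ.1.nonneg
  set t := (P * σ).trace.re with htdef
  have hPpsd : P.PosSemidef := by
    have := posSemidef_self_mul_conjTranspose P
    rwa [hP.eq, hPP] at this
  have htC : ((t : ℝ) : ℂ) = (P * σ).trace := ofReal_re_of_nonneg (trace_mul_nonneg hPpsd hσ.1)
  set C : Matrix κ κ ℂ := Bᴴ
  have hCσ : C * Cᴴ = σ := by simp [C, hB, Matrix.star_eq_conjTranspose]
  -- A root of the normalized projected state `PσP / t`; its overlap with the root `C` of `σ` is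
  -- `√t`.
  set D : Matrix κ κ ℂ := ((√t)⁻¹ : ℂ) • (P * C)
  have hst : ((√t : ℝ) : ℂ) * (√t : ℝ) = t := by
    rw [← Complex.ofReal_mul, Real.mul_self_sqrt ht.le]
  have hst0 : ((√t : ℝ) : ℂ) ≠ 0 := by
    simpa using (Real.sqrt_pos.mpr ht).ne'
  have htr : (P * C * (P * C)ᴴ).trace = t := by
    rw [Matrix.conjTranspose_mul, hP.eq, ← Matrix.mul_assoc, Matrix.trace_mul_comm,
      ← Matrix.mul_assoc, ← Matrix.mul_assoc, hPP, Matrix.mul_assoc, hCσ, htC]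
  have hD : (D * Dᴴ).trace = 1 := by
    simp only [D, Matrix.conjTranspose_smul, Matrix.smul_mul, Matrix.mul_smul, Matrix.trace_smul,
      htr, ← hst]
    simp
    field_simp
  have hov : (C * Dᴴ).trace = (√t : ℝ) := by
    simp only [D, Matrix.conjTranspose_smul, Matrix.mul_smul, Matrix.trace_smul,
      Matrix.conjTranspose_mul, hP.eq]
    rw [← Matrix.mul_assoc, hCσ, Matrix.trace_mul_comm, ← htC, ← hst]
    simp
    field_simp
  refine ⟨D * Dᴴ, ⟨posSemidef_self_mul_conjTranspose _, hD⟩, ?_, ?_⟩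
  · have : D * Dᴴ = P * (((√t)⁻¹ : ℂ) • C * Dᴴ) := by
      simp [D, Matrix.mul_assoc]
    rw [this]
    exact Matrix.rank_mul_le_left _ _
  · have h := traceDist_mul_conjTranspose_le (C := C) (D := D) (by rw [hCσ, hσ.2]; rfl)
      (by rw [hD]; rfl)
    rw [hCσ, hov, Complex.ofReal_re, Real.sq_sqrt ht.le] at h
    exact h

theorem traceDist_le_one {σ τ : Matrix κ κ ℂ} (hσ : IsDensity σ) (hτ : IsDensity τ) :
    traceDist σ τ ≤ 1 := by
  obtain ⟨B, hB⟩ := CStarAlgebra.nonneg_iff_eq_star_mul_self.mp hσ.1.nonneg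
  obtain ⟨B', hB'⟩ := CStarAlgebra.nonneg_iff_eq_star_mul_self.mp hτ.1.nonneg
  have h := traceDist_mul_conjTranspose_le (C := Bᴴ) (D := B'ᴴ)
  simp only [conjTranspose_conjTranspose] at h
  rw [← Matrix.star_eq_conjTranspose, ← Matrix.star_eq_conjTranspose, ← hB, ← hB', hσ.2, hτ.2] at h
  refine (h rfl rfl).trans (Real.sqrt_le_one.mpr ?_)
  nlinarith

theorem exists_isDensity_rank_le_one (h : Nonempty κ) :
    ∃ τ : Matrix κ κ ℂ, IsDensity τ ∧ τ.rank ≤ 1 := by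
  obtain ⟨i⟩ := h
  refine ⟨vecMulVec (Pi.single i 1) (star (Pi.single i 1)),
    ⟨posSemidef_vecMulVec_self_star _, ?_⟩, rank_vecMulVec_le _ _⟩
  simp [Matrix.trace_vecMulVec]

/-- Logarithms of ranks are bounded below by `0` (with `log 0 = 0`), so any admissible `τ` bounds
the infimum. -/
theorem smoothS0_le {σ τ : Matrix κ κ ℂ} {μ b : ℝ} (hτ : IsDensity τ) (hd : traceDist σ τ ≤ μ)
    (hb : Real.logb 2 (τ.rank : ℝ) ≤ b) : smoothS0 μ σ ≤ b := by
  refine le_trans (csInf_le ⟨0, ?_⟩ ⟨τ, ⟨hτ, hd⟩, rfl⟩) hb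
  rintro _ ⟨τ', _, rfl⟩
  rcases Nat.eq_zero_or_pos τ'.rank with h | h
  · simp [h]
  · exact Real.logb_nonneg (by norm_num) (by exact_mod_cast h)

end Gentle

/-! ### Hoeffding's inequality for sequential outcomes -/

section Hoeffding

open MeasureTheory ProbabilityTheory

/-- Hoeffding's lemma for a Bernoulli variable. -/
theorem bernoulli_mgf_le {g : ℝ} (h0 : 0 ≤ g) (h1 : g ≤ 1) (l : ℝ) :
    g * Real.exp (l * (1 - g)) + (1 - g) * Real.exp (l * (0 - g)) ≤ Real.exp (l ^ 2 / 8) := by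
  let μ : Measure ℝ := ENNReal.ofReal g • Measure.dirac 1 + ENNReal.ofReal (1 - g) • Measure.dirac 0
  have hμ : IsProbabilityMeasure μ := ⟨by
    simp [μ, ← ENNReal.ofReal_add h0 (sub_nonneg.mpr h1)]⟩
  have hint : ∀ f : ℝ → ℝ, ∫ x, f x ∂μ = g * f 1 + (1 - g) * f 0 := by
    intro f
    have hd : ∀ a : ℝ, Integrable f (Measure.dirac a) := fun a =>
      (integrable_dirac (by simp))
    rw [integral_add_measure ((hd 1).smul_measure ENNReal.ofReal_ne_top)
      ((hd 0).smul_measure ENNReal.ofReal_ne_top), integral_smul_measure, integral_smul_measure]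
    simp [h0, h1]
  have hX : ∀ᵐ x ∂μ, (id x : ℝ) ∈ Set.Icc (0 : ℝ) 1 := by
    simp only [μ, ae_add_measure_iff]
    constructor <;> refine Measure.ae_smul_measure ?_ _ <;> simp [ae_dirac_eq]
  have h := (hasSubgaussianMGF_of_mem_Icc (μ := μ) aemeasurable_id hX).mgf_le l
  rw [mgf, hint, hint] at h
  simp only [id, mul_one, mul_zero, add_zero] at h
  refine h.trans (le_of_eq ?_)
  congr 1
  simp
  ring

/-- Each string `v` arises once from every `w` that agrees with it off `j`, and there are `|X|` of
these. -/
theorem sum_sum_update {n : ℕ} {X : Type*} [Fintype X] (j : Fin n)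
    (f : (Fin n → X) → ℝ) :
    ∑ w, ∑ x, f (Function.update w j x) = Fintype.card X * ∑ w, f w := by
  classical
  have h : ∀ w : Fin n → X, ∑ x, f (Function.update w j x) =
      ∑ v : Fin n → X, if ∀ i, i ≠ j → v i = w i then f v else 0 := by
    intro w
    rw [← Finset.sum_filter]
    refine Finset.sum_bij' (fun x _ => Function.update w j x) (fun v _ => v j) ?_ ?_ ?_ ?_ ?_
    · intro x _
      simp +contextual [Function.update_of_ne]
    · simp
    · simp
    · intro v hv
      ext i
      by_cases hi : i = j
      · subst hi; simp
      · simp [Function.update_of_ne hi, (Finset.mem_filter.mp hv).2 i hi]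
    · simp
  have hc : ∀ v : Fin n → X, (Finset.univ.filter
      fun w : Fin n → X => ∀ i, i ≠ j → v i = w i).card = Fintype.card X := by
    intro v
    rw [← Finset.card_univ]
    symm
    refine Finset.card_bij' (fun x _ => Function.update v j x) (fun w _ => w j) ?_ ?_ ?_ ?_
    · intro x _
      simp +contextual [Function.update_of_ne]
    · simp
    · simp
    · intro w hw
      ext i
      by_cases hi : i = j
      · subst hi; simp
      · simp [Function.update_of_ne hi, (Finset.mem_filter.mp hw).2 i hi]
  simp only [h]
  rw [Finset.sum_comm, Finset.mul_sum]
  refine Finset.sum_congr rfl fun v _ => ?_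
  rw [← Finset.sum_filter, Finset.sum_const, hc, nsmul_eq_mul]

open Classical in
/-- Exponential moment bound for the deviation of the number of hits of `T` from the sum of the
conditional hit probabilities `g`. Here `P k w` is the probability that the first `k` outcomes are
those of `w`. -/
theorem martingale_mgf_le {n : ℕ} {X : Type*} [Fintype X] (P : ℕ → (Fin n → X) → ℝ)
    (hP : ∀ k w, 0 ≤ P k w) (hP0 : ∀ w, P 0 w = 1)
    (hsum : ∀ (j : Fin n) w, ∑ x, P (j + 1) (Function.update w j x) = P j w)
    (T : Finset X) (g : Fin n → (Fin n → X) → ℝ)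
    (hg : ∀ (j : Fin n) w, P j w * g j w = ∑ x ∈ T, P (j + 1) (Function.update w j x))
    (hginv : ∀ (k j : Fin n) w x, k ≤ j → g k (Function.update w j x) = g k w) (l : ℝ) :
    ∑ w, P n w * Real.exp (l * ∑ k, ((if w k ∈ T then 1 else 0) - g k w)) ≤
      Real.exp (n * (l ^ 2 / 8)) := by
  set D : Fin n → (Fin n → X) → ℝ := fun k w => (if w k ∈ T then 1 else 0) - g k w with hD
  set Φ : ℕ → (Fin n → X) → ℝ := fun j w =>
    P j w * Real.exp (l * ∑ k : Fin n, if (k : ℕ) < j then D k w else 0) with hΦ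
  have step : ∀ (j : Fin n) w, ∑ x, Φ (j + 1) (Function.update w j x) ≤
      Real.exp (l ^ 2 / 8) * Φ j w := by
    intro j w
    have hsplit : ∀ x, (∑ k : Fin n, if (k : ℕ) < (j : ℕ) + 1 then
        D k (Function.update w j x) else 0) =
        (∑ k : Fin n, if (k : ℕ) < j then D k w else 0) + ((if x ∈ T then 1 else 0) - g j w) := by
      intro x
      rw [← Finset.sum_erase_add _ _ (Finset.mem_univ j),
        ← Finset.sum_erase_add (Finset.univ) (fun k : Fin n => if (k : ℕ) < j then D k w else 0)
          (Finset.mem_univ j)]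
      simp only [lt_add_iff_pos_right, zero_lt_one, if_true, lt_irrefl, if_false, add_zero]
      congr 1
      · refine Finset.sum_congr rfl fun k hk => ?_
        have hkj : k ≠ j := Finset.ne_of_mem_erase hk
        have hkj' : (k : ℕ) ≠ j := fun h => hkj (Fin.ext h)
        by_cases hlt : (k : ℕ) < j
        · rw [if_pos hlt, if_pos (by omega)]
          simp only [hD, Function.update_of_ne hkj]
          rw [hginv k j w x (Fin.le_def.mpr hlt.le)]
        · rw [if_neg hlt, if_neg (by omega)]
      · simp [hD, hginv j j w x le_rfl]
    simp only [hΦ, hsplit, mul_add, Real.exp_add]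
    set A := Real.exp (l * ∑ k : Fin n, if (k : ℕ) < j then D k w else 0)
    have hA : 0 < A := Real.exp_pos _
    have hT : ∑ x, P (j + 1) (Function.update w j x) *
        Real.exp (l * ((if x ∈ T then 1 else 0) - g j w)) =
        P j w * (g j w * Real.exp (l * (1 - g j w)) +
          (1 - g j w) * Real.exp (l * (0 - g j w))) := by
      have hcompl : ∑ x ∈ Tᶜ, P (j + 1) (Function.update w j x) = P j w * (1 - g j w) := by
        have := Finset.sum_add_sum_compl T fun x => P (j + 1) (Function.update w j x)
        rw [hsum, ← hg] at this
        linarith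
      rw [← Finset.sum_add_sum_compl T, mul_add, ← mul_assoc, ← mul_assoc, ← hcompl, hg,
        Finset.sum_mul, Finset.sum_mul]
      congr 1
      · exact Finset.sum_congr rfl fun x hx => by rw [if_pos hx]
      · exact Finset.sum_congr rfl fun x hx => by rw [if_neg (Finset.mem_compl.mp hx)]
    have hle : P j w * (g j w * Real.exp (l * (1 - g j w)) +
          (1 - g j w) * Real.exp (l * (0 - g j w))) ≤ P j w * Real.exp (l ^ 2 / 8) := by
      -- The values of `g` are known to lie in `[0, 1]` only after a prefix of positive probability;
      -- otherwise both sides vanish.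
      rcases (hP j w).eq_or_lt with h0 | h0
      · simp [← h0]
      · refine mul_le_mul_of_nonneg_left (bernoulli_mgf_le ?_ ?_ l) h0.le
        · refine nonneg_of_mul_nonneg_right ?_ h0
          rw [hg]
          exact Finset.sum_nonneg fun x _ => hP _ _
        · have : P j w * g j w ≤ P j w := by
            rw [hg, ← hsum j w]
            exact Finset.sum_le_univ_sum_of_nonneg fun x => hP _ _
          nlinarith
    calc _ = A * ∑ x, P (j + 1) (Function.update w j x) *
        Real.exp (l * ((if x ∈ T then 1 else 0) - g j w)) := by
          rw [Finset.mul_sum]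
          exact Finset.sum_congr rfl fun x _ => by ring
      _ ≤ A * (P j w * Real.exp (l ^ 2 / 8)) := by rw [hT]; gcongr
      _ = _ := by ring
  -- Sums run over full strings although `Φ j` stands for a weight on prefixes of length `j`. The
  -- powers of `|X|` account for the `n - j` free letters and cancel at `j = n`.
  have main : ∀ j : ℕ, j ≤ n → (Fintype.card X : ℝ) ^ j * ∑ w, Φ j w ≤
      Real.exp (j * (l ^ 2 / 8)) * (Fintype.card X : ℝ) ^ n := by
    intro j
    induction j with
    | zero =>
      intro _
      simp [hΦ, hP0]
    | succ j ih =>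
      intro hj
      have h1 := sum_sum_update (⟨j, hj⟩ : Fin n) (Φ (j + 1))
      have h2 := Finset.sum_le_sum fun w (_ : w ∈ Finset.univ) => step ⟨j, hj⟩ w
      rw [← Finset.mul_sum] at h2
      simp only at h2
      rw [h1] at h2
      calc (Fintype.card X : ℝ) ^ (j + 1) * ∑ w, Φ (j + 1) w
          = (Fintype.card X : ℝ) ^ j * (Fintype.card X * ∑ w, Φ (j + 1) w) := by ring
        _ ≤ (Fintype.card X : ℝ) ^ j * (Real.exp (l ^ 2 / 8) * ∑ w, Φ j w) := by gcongr
        _ = Real.exp (l ^ 2 / 8) * ((Fintype.card X : ℝ) ^ j * ∑ w, Φ j w) := by ring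
        _ ≤ Real.exp (l ^ 2 / 8) * (Real.exp (j * (l ^ 2 / 8)) * (Fintype.card X : ℝ) ^ n) :=
          mul_le_mul_of_nonneg_left (ih (by omega)) (Real.exp_nonneg _)
        _ = _ := by
          rw [← mul_assoc, ← Real.exp_add]
          push_cast
          ring_nf
  have hfin : ∑ w, P n w * Real.exp (l * ∑ k, D k w) = ∑ w, Φ n w := by
    simp [hΦ]
  rw [hfin]
  rcases isEmpty_or_nonempty (Fin n → X) with he | he
  · simp [Real.exp_nonneg]
  · have hc : (0 : ℝ) < (Fintype.card X : ℝ) ^ n := by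
      have : 0 < Fintype.card (Fin n → X) := Fintype.card_pos
      rw [Fintype.card_fun, Fintype.card_fin] at this
      exact_mod_cast this
    have := main n le_rfl
    rw [mul_comm (Real.exp _)] at this
    exact le_of_mul_le_mul_left this hc

end Hoeffding

/-! ### Frequencies, entropy and counting by types -/

section Types

variable {Y : Type*} [Fintype Y]

theorem varDist_comm (f g : Y → ℝ) : varDist f g = varDist g f := by
  simp only [varDist, abs_sub_comm]

theorem varDist_le_one {f g : Y → ℝ} (hf : IsProb f) (hg : IsProb g) : varDist f g ≤ 1 := by
  have : ∑ y, |f y - g y| ≤ ∑ y, (f y + g y) := Finset.sum_le_sum fun y _ => by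
    rw [abs_le]
    constructor <;> linarith [hf.1 y, hg.1 y]
  rw [Finset.sum_add_distrib, hf.2, hg.2] at this
  rw [varDist]
  linarith

open Classical in
theorem varDist_eq_sum_filter {f g : Y → ℝ} (hf : IsProb f) (hg : IsProb g) :
    varDist f g = ∑ y with g y < f y, (f y - g y) := by
  have h1 : ∀ y, |f y - g y| = 2 * (if g y < f y then f y - g y else 0) - (f y - g y) := by
    intro y
    split_ifs with h
    · rw [abs_of_pos (by linarith)]; ring
    · rw [abs_of_nonpos (by linarith)]; ring
  rw [varDist, Finset.sum_congr rfl fun y _ => h1 y, Finset.sum_sub_distrib, ← Finset.mul_sum,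
    Finset.sum_sub_distrib, hf.2, hg.2, Finset.sum_filter]
  ring

/-- Additive deviation bounds for the counts `c` around `q n g` bound the distance between the
normalized counts `f` and `g`. -/
theorem varDist_le_of_deviation {f g c : Y → ℝ} (hf : IsProb f) (hg : IsProb g) {N q ε n : ℝ}
    (hq : 0 < q) (hε : 0 < ε) (hn : 0 < n) (hc : ∀ y, c y = N * f y)
    (hup : ∀ S : Finset Y, S.Nonempty → ∑ y ∈ S, c y - q * n * ∑ y ∈ S, g y ≤ n * (ε / 4))
    (hlow : q * n - N ≤ n * (ε / 4)) : varDist f g ≤ ε / q := by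
  classical
  -- For `q ≤ ε` the bound exceeds the trivial `1`. Otherwise the lower deviation forces `N ≥ qn/2`.
  rcases le_or_gt q ε with h | h
  · exact (varDist_le_one hf hg).trans ((one_le_div hq).mpr h)
  · rw [varDist_eq_sum_filter hf hg]
    set S := Finset.univ.filter fun y => g y < f y
    rcases S.eq_empty_or_nonempty with hS | hS
    · rw [hS, Finset.sum_empty]; positivity
    · have h1 := hup S hS
      have hgS0 : 0 ≤ ∑ y ∈ S, g y := Finset.sum_nonneg fun y _ => hg.1 y
      have hgS1 : ∑ y ∈ S, g y ≤ 1 := hg.2 ▸ Finset.sum_le_univ_sum_of_nonneg hg.1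
      simp only [hc, ← Finset.mul_sum] at h1
      rw [Finset.sum_sub_distrib, le_div_iff₀ hq]
      set a := ∑ y ∈ S, f y
      set b := ∑ y ∈ S, g y
      have hnε : n * ε < n * q := by gcongr
      have hN : q * n / 2 ≤ N := by nlinarith
      have hNpos : 0 < N := lt_of_lt_of_le (by positivity) hN
      -- Here `N(a - b) = (Na - qnb) + (qn - N)b`, and each summand is at most `nε/4` because `0 ≤ b
      -- ≤ 1`. Dividing by `N ≥ qn/2` gives `ε/q`.
      have h2 : N * (a - b) ≤ n * ε / 2 := by
        have : (q * n - N) * b ≤ n * (ε / 4) := by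
          rcases le_total 0 (q * n - N) with h' | h'
          · nlinarith
          · have : 0 ≤ n * (ε / 4) := by positivity
            nlinarith
        nlinarith
      rcases le_total (a - b) 0 with h' | h'
      · nlinarith
      · have h3 : n * ((a - b) * q) ≤ n * ε := by nlinarith
        exact le_of_mul_le_mul_left h3 hn

/-- From `log x ≥ 1 - 1/x`, each `-x log x` is at most `1`. Boundedness is needed for the real
supremum to dominate its members. -/
theorem bddAbove_shannon {B : Set (Y → ℝ)} (hB : ∀ P ∈ B, IsProb P) :
    BddAbove (shannon '' B) := by
  refine ⟨Fintype.card Y * (1 / Real.log 2), ?_⟩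
  rintro _ ⟨P, hP, rfl⟩
  rw [shannon, ← Finset.sum_neg_distrib, ← nsmul_eq_mul, ← Finset.card_univ, ← Finset.sum_const]
  refine Finset.sum_le_sum fun y _ => ?_
  have hl : 0 < Real.log 2 := Real.log_pos (by norm_num)
  rw [Real.logb, ← mul_div_assoc, ← neg_div]
  gcongr
  rcases ((hB P hP).1 y).eq_or_lt with h | h
  · simp [← h]
  · have := Real.one_sub_inv_le_log_of_pos h
    have h2 : P y * (1 - (P y)⁻¹) ≤ P y * Real.log (P y) := by gcongr
    rw [mul_sub, mul_inv_cancel₀ h.ne'] at h2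
    linarith

theorem shannonMax_nonneg {B : Set (Y → ℝ)} (hB : ∀ P ∈ B, IsProb P) : 0 ≤ shannonMax B := by
  refine Real.sSup_nonneg ?_
  rintro _ ⟨P, hP, rfl⟩
  rw [shannon, neg_nonneg]
  refine Finset.sum_nonpos fun y _ => mul_nonpos_of_nonneg_of_nonpos ((hB P hP).1 y) ?_
  refine Real.logb_nonpos (by norm_num) ((hB P hP).1 y) ?_
  rw [← (hB P hP).2]
  exact Finset.single_le_sum (fun z _ => (hB P hP).1 z) (Finset.mem_univ y)

variable {κ : Type*} [Fintype κ] [DecidableEq Y]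

theorem card_mul_freq (Q₀ : Y → ℝ) (w : κ → Y) (y : Y) :
    (Fintype.card κ : ℝ) * freq Q₀ w y = (Finset.univ.filter fun i => w i = y).card := by
  unfold freq
  split_ifs with h
  · have : IsEmpty κ := Fintype.card_eq_zero_iff.mp h
    simp
  · have : (Fintype.card κ : ℝ) ≠ 0 := by exact_mod_cast h
    field_simp

theorem isProb_freq {Q₀ : Y → ℝ} (w : κ → Y) (h : Fintype.card κ = 0 → IsProb Q₀) :
    IsProb (freq Q₀ w) := by
  by_cases hc : Fintype.card κ = 0
  · simpa [freq, hc] using h hc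
  · have hc' : (Fintype.card κ : ℝ) ≠ 0 := by exact_mod_cast hc
    simp only [freq, hc, if_false]
    refine ⟨fun y => by positivity, ?_⟩
    rw [← Finset.sum_div, div_eq_one_iff_eq hc', ← Nat.cast_sum,
      ← Finset.card_eq_sum_card_fiberwise (fun _ _ => Finset.mem_coe.mpr (Finset.mem_univ _)),
      Finset.card_univ]

/-- The number of sequences whose types lie in a convex set. -/
theorem logb_card_le_of_freq_mem {B : Set (Y → ℝ)} (hB : ∀ P ∈ B, IsProb P) (hconv : Convex ℝ B)
    (Q₀ : Y → ℝ) (W : Finset (κ → Y)) (hW : ∀ w ∈ W, freq Q₀ w ∈ B) (hne : W.Nonempty) :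
    Real.logb 2 W.card ≤ Fintype.card κ * shannonMax B := by
  classical
  have hM : (0 : ℝ) < W.card := by exact_mod_cast hne.card_pos
  -- The average type stays in `B` by convexity. The product law of `P` gives `W` mass at most `1`,
  -- and the mean of its log-likelihood over `W` is exactly `-|κ|` times the entropy of `P`; hence
  -- no polynomial factor appears.
  set P : Y → ℝ := ∑ w ∈ W, (W.card : ℝ)⁻¹ • freq Q₀ w with hPdef
  have hP : P ∈ B := hconv.sum_mem (fun _ _ => by positivity)
    (by simp [hM.ne']) hW
  have hprob := hB P hP
  refine le_trans ?_ (mul_le_mul_of_nonneg_left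
    (le_csSup (bddAbove_shannon hB) (Set.mem_image_of_mem _ hP)) (by positivity))
  have hPy : ∀ y, (W.card : ℝ) * (Fintype.card κ * P y) =
      ∑ w ∈ W, ((Finset.univ.filter fun i => w i = y).card : ℝ) := by
    intro y
    simp only [hPdef, Finset.sum_apply, Pi.smul_apply, smul_eq_mul, ← Finset.mul_sum,
      ← card_mul_freq Q₀]
    field_simp
  have hpos : ∀ w ∈ W, ∀ i, 0 < P (w i) := by
    intro w hw i
    have h1 : (0 : ℝ) < ∑ v ∈ W, ((Finset.univ.filter fun j => v j = w i).card : ℝ) := by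
      refine Finset.sum_pos' (fun _ _ => by positivity) ⟨w, hw, ?_⟩
      exact_mod_cast Finset.card_pos.mpr ⟨i, by simp⟩
    rw [← hPy] at h1
    by_contra hcon
    have : P (w i) = 0 := le_antisymm (not_lt.mp hcon) (hprob.1 _)
    simp [this] at h1
  have hsum : ∑ w ∈ W, ∏ i, P (w i) ≤ 1 := by
    calc ∑ w ∈ W, ∏ i, P (w i) ≤ ∑ w : κ → Y, ∏ i, P (w i) :=
          Finset.sum_le_univ_sum_of_nonneg fun w => Finset.prod_nonneg fun i _ => hprob.1 _
      _ = ∏ _i : κ, ∑ y, P y := by rw [Finset.prod_univ_sum]; simp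
      _ = 1 := by simp [hprob.2]
  have hlog : ∑ w ∈ W, (Real.log W.card + ∑ i, Real.log (P (w i))) ≤ 0 := by
    -- Uses `log x ≤ x - 1` at `x = |W| ∏ P(wᵢ)`, in place of comparing relative entropies.
    calc _ ≤ ∑ w ∈ W, ((W.card : ℝ) * ∏ i, P (w i) - 1) := by
          refine Finset.sum_le_sum fun w hw => ?_
          have hp : 0 < ∏ i, P (w i) := Finset.prod_pos fun i _ => hpos w hw i
          rw [← Real.log_prod (fun i _ => (hpos w hw i).ne'), ← Real.log_mul hM.ne' hp.ne']
          exact Real.log_le_sub_one_of_pos (by positivity)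
      _ = (W.card : ℝ) * ∑ w ∈ W, ∏ i, P (w i) - W.card := by
          rw [Finset.sum_sub_distrib, Finset.mul_sum]; simp
      _ ≤ 0 := by nlinarith
  have hcount : ∑ w ∈ W, ∑ i, Real.log (P (w i)) =
      W.card * (Fintype.card κ * ∑ y, P y * Real.log (P y)) := by
    have h1 : ∀ w : κ → Y, ∑ i, Real.log (P (w i)) =
        ∑ y, ((Finset.univ.filter fun i => w i = y).card : ℝ) * Real.log (P y) := by
      intro w
      rw [← Finset.sum_fiberwise Finset.univ w]
      refine Finset.sum_congr rfl fun y _ => ?_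
      rw [Finset.sum_congr rfl (g := fun _ => Real.log (P y))
        (fun i hi => by rw [(Finset.mem_filter.mp hi).2])]
      simp
    simp only [h1]
    rw [Finset.sum_comm, Finset.mul_sum, Finset.mul_sum]
    refine Finset.sum_congr rfl fun y _ => ?_
    rw [← Finset.sum_mul, ← hPy]
    ring
  rw [Finset.sum_add_distrib, hcount] at hlog
  simp only [Finset.sum_const, nsmul_eq_mul] at hlog
  have hfin : Real.log W.card ≤ Fintype.card κ * -∑ y, P y * Real.log (P y) := by
    rw [← mul_add] at hlog
    have := nonpos_of_mul_nonpos_right hlog hM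
    linarith
  have hl : 0 < Real.log 2 := Real.log_pos (by norm_num)
  have hsh : shannon P = (-∑ y, P y * Real.log (P y)) / Real.log 2 := by
    simp only [shannon, Real.logb, neg_div, Finset.sum_div, mul_div_assoc]
  rw [hsh, Real.logb, ← mul_div_assoc]
  gcongr

end Types

/-! ### Convexity of the compatible set -/

section Convexity

theorem convex_isProb {Y : Type*} [Fintype Y] : Convex ℝ {P : Y → ℝ | IsProb P} := by
  intro P hP Q hQ a b ha hb hab
  refine ⟨fun y => ?_, ?_⟩
  · have := hP.1 y
    have := hQ.1 y
    simp only [Pi.add_apply, Pi.smul_apply, smul_eq_mul]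
    positivity
  · simp [Finset.sum_add_distrib, ← Finset.mul_sum, hP.2, hQ.2, hab]

theorem convex_probBall {Y : Type*} [Fintype Y] {W : Set (Y → ℝ)} (hW : Convex ℝ W) (η : ℝ) :
    Convex ℝ (probBall η W) := by
  rintro P ⟨hP, P', hP', hPd⟩ Q ⟨hQ, Q', hQ', hQd⟩ a b ha hb hab
  refine ⟨convex_isProb hP hQ ha hb hab, a • P' + b • Q', hW hP' hQ' ha hb hab, ?_⟩
  have h : varDist (a • P' + b • Q') (a • P + b • Q) ≤ a * varDist P' P + b * varDist Q' Q := by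
    simp only [varDist]
    rw [mul_left_comm, mul_left_comm b, ← mul_add]
    refine mul_le_mul_of_nonneg_left ?_ (by norm_num)
    rw [Finset.mul_sum, Finset.mul_sum, ← Finset.sum_add_distrib]
    refine Finset.sum_le_sum fun y _ => ?_
    have : (a • P' + b • Q') y - (a • P + b • Q) y = a * (P' y - P y) + b * (Q' y - Q y) := by
      simp; ring
    rw [this]
    refine (abs_add_le _ _).trans ?_
    rw [abs_mul, abs_mul, abs_of_nonneg ha, abs_of_nonneg hb]
  calc _ ≤ _ := h
    _ ≤ a * η + b * η := by gcongr
    _ = η := by rw [← add_mul, hab, one_mul]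

theorem convex_isDensity {κ : Type*} [Fintype κ] :
    Convex ℝ {ρ : Matrix κ κ ℂ | IsDensity ρ} := by
  intro P hP Q hQ a b ha hb hab
  refine ⟨(hP.1.smul ha).add (hQ.1.smul hb), ?_⟩
  rw [Matrix.trace_add, Matrix.trace_smul, Matrix.trace_smul, hP.2, hQ.2, ← add_smul, hab, one_smul]

/-- The measurement mapping as a linear map. -/
def POVM.measLin {Z κ : Type*} [Fintype Z] [Fintype κ] [DecidableEq κ] (F : POVM Z κ) :
    Matrix κ κ ℂ →ₗ[ℝ] (Z → ℝ) where
  toFun := F.meas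
  map_add' ρ σ := by
    ext z; simp [POVM.meas, Matrix.mul_add]
  map_smul' c ρ := by
    ext z; simp [POVM.meas]

theorem POVM.isProb_meas {Z κ : Type*} [Fintype Z] [Fintype κ] [DecidableEq κ] (F : POVM Z κ)
    {ρ : Matrix κ κ ℂ} (hρ : IsDensity ρ) : IsProb (F.meas ρ) := by
  refine ⟨fun z => (Complex.nonneg_iff.mp (trace_mul_nonneg (F.pos z) hρ.1)).1, ?_⟩
  simp only [POVM.meas]
  rw [← Complex.re_sum, ← Matrix.trace_sum, ← Matrix.sum_mul, F.sum_eq, Matrix.one_mul, hρ.2]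
  rfl

theorem convex_compatible {ι Z Z' : Type*} [Fintype ι] [DecidableEq ι] [Fintype Z] [Fintype Z']
    (F : POVM Z ι) (F' : POVM Z' ι) {R : Set (Matrix ι ι ℂ)} (hR : Convex ℝ R) (p ε : ℝ)
    (Q : Z → ℝ) : Convex ℝ (compatible F F' R p ε Q) := by
  refine convex_probBall ?_ _
  refine Convex.linear_image (hR.inter ?_) F'.measLin
  exact convex_isDensity.inter
    ((convex_probBall (convex_singleton Q) _).linear_preimage F.measLin)

end Convexity

/-! ### Sequential measurement and the average conditional state -/

section Sequential

variable {n : ℕ} {ι X : Type*} [Fintype ι] [DecidableEq ι] [Fintype X]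

theorem prodOp_eq_tens {Z : Type*} [Fintype Z] (F : POVM Z ι) (s : Finset (Fin n))
    (z : {i // i ∈ s} → Z) : prodOp F s z = tens fun i => F.op (z i) := rfl

theorem prodOp_posSemidef {Z : Type*} [Fintype Z] (F : POVM Z ι) (s : Finset (Fin n))
    (z : {i // i ∈ s} → Z) : (prodOp F s z).PosSemidef :=
  tens_posSemidef fun i => F.pos (z i)

theorem sum_prodOp {Z : Type*} [Fintype Z] (F : POVM Z ι) (s : Finset (Fin n)) :
    ∑ z, prodOp F s z = 1 := by
  simp only [prodOp_eq_tens]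
  rw [sum_tens (fun _ x => F.op x)]
  simp only [F.sum_eq, tens_one]

/-- Factors of the measurement operator for the first `k` outcomes of `w`. -/
def prefixFactor (G : POVM X ι) (k : ℕ) (w : Fin n → X) : Fin n → Matrix ι ι ℂ :=
  fun i => if (i : ℕ) < k then G.op (w i) else 1

/-- Probability of the first `k` outcomes of `w` when all factors are measured with `G`. -/
def prefixProb (G : POVM X ι) (ρ : Matrix (Fin n → ι) (Fin n → ι) ℂ) (k : ℕ) (w : Fin n → X) : ℝ :=
  (tens (prefixFactor G k w) * ρ).trace.re

/-- The unnormalized state of the `k`-th factor given the preceding outcomes of `w`. -/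
def siteGiven (G : POVM X ι) (ρ : Matrix (Fin n → ι) (Fin n → ι) ℂ) (k : Fin n) (w : Fin n → X) :
    Matrix ι ι ℂ :=
  siteOp ρ k (prodOp G (Finset.Iio k) fun i => w i)

/-- The state of the `k`-th factor given the preceding outcomes of `w`. -/
def siteState (G : POVM X ι) (ρ : Matrix (Fin n → ι) (Fin n → ι) ℂ) (k : Fin n) (w : Fin n → X) :
    Matrix ι ι ℂ :=
  (siteGiven G ρ k w).trace⁻¹ • siteGiven G ρ k w

variable (G : POVM X ι) {ρ : Matrix (Fin n → ι) (Fin n → ι) ℂ}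

theorem prefixFactor_posSemidef (k : ℕ) (w : Fin n → X) (i : Fin n) :
    (prefixFactor G k w i).PosSemidef := by
  unfold prefixFactor
  split_ifs
  exacts [G.pos _, PosSemidef.one]

theorem prefixProb_nonneg (hρ : IsDensity ρ) (k : ℕ) (w : Fin n → X) :
    0 ≤ prefixProb G ρ k w :=
  (Complex.nonneg_iff.mp
    (trace_mul_nonneg (tens_posSemidef (prefixFactor_posSemidef G k w)) hρ.1)).1

theorem prefixProb_zero (hρ : IsDensity ρ) (w : Fin n → X) : prefixProb G ρ 0 w = 1 := by
  have : prefixFactor G 0 w = fun _ => 1 := by ext1 i; simp [prefixFactor]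
  rw [prefixProb, this, tens_one, Matrix.one_mul, hρ.2, Complex.one_re]

theorem prefixFactor_succ_update (j : Fin n) (w : Fin n → X) (x : X) :
    prefixFactor G (j + 1) (Function.update w j x) =
      Function.update (prefixFactor G j w) j (G.op x) := by
  ext1 i
  by_cases hi : i = j
  · subst hi; simp [prefixFactor]
  · have : (i : ℕ) ≠ j := fun h => hi (Fin.ext h)
    have h2 : (i : ℕ) < j + 1 ↔ (i : ℕ) < j := by omega
    simp [prefixFactor, Function.update_of_ne hi, h2]

theorem sum_prefixProb_succ_update (j : Fin n) (w : Fin n → X) (T : Finset X) :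
    ∑ x ∈ T, prefixProb G ρ (j + 1) (Function.update w j x) =
      (tens (Function.update (prefixFactor G j w) j (∑ x ∈ T, G.op x)) * ρ).trace.re := by
  simp only [prefixProb, prefixFactor_succ_update]
  rw [← sum_tens_update, Matrix.sum_mul, Matrix.trace_sum, Complex.re_sum]

theorem sum_prefixProb_succ (j : Fin n) (w : Fin n → X) :
    ∑ x, prefixProb G ρ (j + 1) (Function.update w j x) = prefixProb G ρ j w := by
  rw [sum_prefixProb_succ_update, G.sum_eq, prefixProb]
  congr 4
  exact Function.update_eq_self_iff.mpr (by simp [prefixFactor])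

theorem prefixProb_succ_le (hρ : IsDensity ρ) (j : Fin n) (w : Fin n → X) :
    prefixProb G ρ (j + 1) w ≤ prefixProb G ρ j w := by
  rw [← sum_prefixProb_succ]
  have := Finset.single_le_sum (f := fun x => prefixProb G ρ (j + 1) (Function.update w j x))
    (fun x _ => prefixProb_nonneg G hρ _ _) (Finset.mem_univ (w j))
  simpa using this

theorem prefixProb_pos (hρ : IsDensity ρ) {w : Fin n → X} (hw : 0 < prefixProb G ρ n w)
    (j : ℕ) (hj : j ≤ n) : 0 < prefixProb G ρ j w := by
  induction hj using Nat.decreasingInduction with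
  | of_succ k hk ih => exact ih.trans_le (prefixProb_succ_le G hρ ⟨k, hk⟩ w)
  | self => exact hw

/-- Testing the unnormalized state of factor `k` with `B` puts `B` into slot `k` of the prefix
operator. The choices `B = 1` and `B = G.op x` give its trace and the next prefix probability. -/
theorem trace_mul_siteGiven (k : Fin n) (w : Fin n → X) (B : Matrix ι ι ℂ) :
    (B * siteGiven G ρ k w).trace =
      (tens (Function.update (prefixFactor G k w) k B) * ρ).trace := by
  have h1 : (B * siteGiven G ρ k w).trace =
      (tens (fun _ : {i // i ∈ ({k} : Finset (Fin n))} => B) *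
        reduce {k} (embed (Finset.Iio k) (prodOp G (Finset.Iio k) fun i => w i) * ρ)).trace := by
    have : Unique {i // i ∈ ({k} : Finset (Fin n))} :=
      ⟨⟨⟨k, by simp⟩⟩, fun i => Subtype.ext (Finset.mem_singleton.mp i.2)⟩
    simp only [Matrix.trace, Matrix.diag_apply, Matrix.mul_apply]
    rw [← (Equiv.funUnique {i // i ∈ ({k} : Finset (Fin n))} ι).symm.sum_comp]
    refine Finset.sum_congr rfl fun x _ => ?_
    rw [← (Equiv.funUnique {i // i ∈ ({k} : Finset (Fin n))} ι).symm.sum_comp]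
    refine Finset.sum_congr rfl fun y _ => ?_
    congr 1
    simp [tens]
  rw [h1, trace_mul_reduce, embed_tens, prodOp_eq_tens, embed_tens, ← Matrix.mul_assoc, tens_mul]
  congr 3
  ext1 i
  by_cases hi : i = k
  · subst hi; simp
  · by_cases hlt : i < k
    · simp [hi, hlt, prefixFactor]
    · have : ¬ ((i : ℕ) < k) := hlt
      simp [hi, hlt, this, prefixFactor]

theorem siteGiven_posSemidef (hρ : IsDensity ρ) (k : Fin n) (w : Fin n → X) :
    (siteGiven G ρ k w).PosSemidef :=
  (reduce_embed_mul_posSemidef (s := Finset.Iio k) (t := {k}) (by simp) hρ.1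
    (prodOp_posSemidef G _ _)).submatrix fun i _ => i

theorem siteGiven_trace (hρ : IsDensity ρ) (k : Fin n) (w : Fin n → X) :
    (siteGiven G ρ k w).trace = (prefixProb G ρ k w : ℝ) := by
  have h := trace_mul_siteGiven (ρ := ρ) G k w 1
  rw [Matrix.one_mul, Function.update_eq_self_iff.mpr (by simp [prefixFactor])] at h
  rw [h, prefixProb, ofReal_re_of_nonneg
    (trace_mul_nonneg (tens_posSemidef (prefixFactor_posSemidef G k w)) hρ.1)]

theorem prefixProb_mul_meas (hρ : IsDensity ρ) (k : Fin n) (w : Fin n → X) (T : Finset X) :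
    prefixProb G ρ k w * ∑ x ∈ T, G.meas (siteState G ρ k w) x =
      ∑ x ∈ T, prefixProb G ρ (k + 1) (Function.update w k x) := by
  rw [Finset.mul_sum]
  refine Finset.sum_congr rfl fun x _ => ?_
  have h1 : prefixProb G ρ (k + 1) (Function.update w k x) =
      (G.op x * siteGiven G ρ k w).trace.re := by
    rw [trace_mul_siteGiven, prefixProb, prefixFactor_succ_update]
  rw [h1, POVM.meas, siteState, siteGiven_trace G hρ]
  -- For a prefix of probability zero the unnormalized state is positive of trace zero, hence zero,
  -- so the identity holds despite the division by zero.
  by_cases h0 : prefixProb G ρ k w = 0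
  · have : siteGiven G ρ k w = 0 := by
      rw [← (siteGiven_posSemidef G hρ k w).trace_eq_zero_iff, siteGiven_trace G hρ, h0]
      simp
    simp [this]
  · rw [Matrix.mul_smul, Matrix.trace_smul, ← Complex.ofReal_inv, smul_eq_mul,
      Complex.re_ofReal_mul, mul_inv_cancel_left₀ h0]

theorem siteState_isDensity (hρ : IsDensity ρ) {k : Fin n} {w : Fin n → X}
    (h : 0 < prefixProb G ρ k w) : IsDensity (siteState G ρ k w) := by
  have h0 : ((prefixProb G ρ k w : ℝ) : ℂ) ≠ 0 := by exact_mod_cast h.ne'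
  refine ⟨(siteGiven_posSemidef G hρ k w).smul ?_, ?_⟩
  · rw [siteGiven_trace G hρ, ← Complex.ofReal_inv]
    exact_mod_cast (inv_pos.mpr h).le
  · rw [siteState, Matrix.trace_smul, smul_eq_mul, siteGiven_trace G hρ, inv_mul_cancel₀ h0]

theorem siteState_mem_densityRange (hρ : IsDensity ρ) {k : Fin n} {w : Fin n → X}
    (h : 0 < prefixProb G ρ k w) : siteState G ρ k w ∈ densityRange ρ := by
  classical
  apply subset_convexHull
  let e := Fintype.equivFin ({i // i ∈ Finset.Iio k} → X)
  refine ⟨k, _, ⟨fun x => prodOp G _ (e.symm x), fun x => prodOp_posSemidef G _ _, ?_⟩,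
    e fun i => w i, ?_, ?_⟩
  · rw [e.symm.sum_comp (fun x => prodOp G _ x), sum_prodOp]
  · simp only [Equiv.symm_apply_apply]
    change (siteGiven G ρ k w).trace ≠ 0
    rw [siteGiven_trace G hρ]
    exact_mod_cast h.ne'
  · simp only [Equiv.symm_apply_apply]
    rfl

/-- The average over all factors of their states given the preceding outcomes of `w`. -/
def avgState (G : POVM X ι) (ρ : Matrix (Fin n → ι) (Fin n → ι) ℂ) (w : Fin n → X) :
    Matrix ι ι ℂ :=
  ∑ k : Fin n, (n : ℝ)⁻¹ • siteState G ρ k w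

theorem avgState_mem (hρ : IsDensity ρ) (hn : 0 < n) {w : Fin n → X}
    (hw : 0 < prefixProb G ρ n w) {C : Set (Matrix ι ι ℂ)} (hC : Convex ℝ C)
    (h : ∀ k : Fin n, 0 < prefixProb G ρ k w → siteState G ρ k w ∈ C) : avgState G ρ w ∈ C := by
  have : (n : ℝ) ≠ 0 := by exact_mod_cast hn.ne'
  exact hC.sum_mem (fun _ _ => by positivity) (by simp [this])
    fun k _ => h k (prefixProb_pos G hρ hw k k.2.le)

theorem meas_avgState {Y : Type*} [Fintype Y] (F : POVM Y ι) (hn : 0 < n) (w : Fin n → X) (y : Y) :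
    n * F.meas (avgState G ρ w) y = ∑ k, F.meas (siteState G ρ k w) y := by
  have hn' : (n : ℝ) ≠ 0 := by exact_mod_cast hn.ne'
  have h : F.measLin (avgState G ρ w) y = ∑ k, (n : ℝ)⁻¹ * F.measLin (siteState G ρ k w) y := by
    simp [avgState, map_sum]
  rw [← Finset.mul_sum] at h
  change n * F.measLin (avgState G ρ w) y = ∑ k, F.measLin (siteState G ρ k w) y
  rw [h, mul_inv_cancel_left₀ hn']

open Classical in
/-- Deviation of the number of outcomes in `T` from the sum of their conditional probabilities. -/
def deviation (G : POVM X ι) (ρ : Matrix (Fin n → ι) (Fin n → ι) ℂ) (T : Finset X)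
    (w : Fin n → X) : ℝ :=
  ∑ k : Fin n, ((if w k ∈ T then 1 else 0) - ∑ x ∈ T, G.meas (siteState G ρ k w) x)

-- Chernoff bound: the exponential moment at `l = ±ε` is at most `e^(nε²/8)`, and the threshold
-- `nε²/4` on `l * deviation` contributes `e^(-nε²/4)`.
open Classical in
theorem sum_deviation_tail_le (hρ : IsDensity ρ) (T : Finset X) {l ε : ℝ} (hl : l ^ 2 = ε ^ 2) :
    ∑ w : Fin n → X, (if n * (ε ^ 2 / 4) < l * deviation G ρ T w then prefixProb G ρ n w else 0) ≤
      Real.exp (-(n * ε ^ 2 / 8)) := by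
  have h := martingale_mgf_le (prefixProb G ρ) (prefixProb_nonneg G hρ) (prefixProb_zero G hρ)
    (sum_prefixProb_succ G) T
    (fun k w => ∑ x ∈ T, G.meas (siteState G ρ k w) x)
    (fun j w => prefixProb_mul_meas G hρ j w T) (fun k j w x hkj => by
      have : siteGiven G ρ k (Function.update w j x) = siteGiven G ρ k w := by
        unfold siteGiven
        congr 2
        ext i
        have := Finset.mem_Iio.mp i.2
        rw [Function.update_of_ne (by rintro h; exact absurd (h ▸ hkj) (not_le.mpr this))]
      simp only [siteState, this]) l
  have hm : ∀ w : Fin n → X,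
      (if n * (ε ^ 2 / 4) < l * deviation G ρ T w then prefixProb G ρ n w else 0) ≤
      Real.exp (-(n * (ε ^ 2 / 4))) * (prefixProb G ρ n w * Real.exp (l * deviation G ρ T w)) := by
    intro w
    have hp := prefixProb_nonneg G hρ n w
    split_ifs with hlt
    · rw [mul_left_comm, ← Real.exp_add]
      refine le_mul_of_one_le_right hp (Real.one_le_exp ?_)
      linarith
    · positivity
  refine (Finset.sum_le_sum fun w _ => hm w).trans ?_
  rw [← Finset.mul_sum]
  refine (mul_le_mul_of_nonneg_left h (Real.exp_nonneg _)).trans ?_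
  rw [← Real.exp_add, hl]
  apply le_of_eq
  congr 1
  ring

/-- Some number of outcomes in a part `Y` of the outcome set deviates too much. -/
def HasTail {Y : Type*} [Fintype Y] (G : POVM X ι) (ρ : Matrix (Fin n → ι) (Fin n → ι) ℂ) (ε : ℝ)
    (e : Y ↪ X) (w : Fin n → X) : Prop :=
  (∃ S : Finset Y, S.Nonempty ∧ n * (ε ^ 2 / 4) < ε * deviation G ρ (S.map e) w) ∨
    n * (ε ^ 2 / 4) < -ε * deviation G ρ (Finset.univ.map e) w

open Classical in
theorem sum_hasTail_le {Y : Type*} [Fintype Y] (hρ : IsDensity ρ) (ε : ℝ) (e : Y ↪ X) :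
    ∑ w : Fin n → X, (if HasTail G ρ ε e w then prefixProb G ρ n w else 0) ≤
      2 ^ Fintype.card Y * Real.exp (-(n * ε ^ 2 / 8)) := by
  -- The empty set yields no upper-tail event, so its slot carries the lower tail for all of `Y`.
  -- The union bound thus has exactly `2^|Y|` terms.
  let T : Finset Y → Finset X := fun S => if S.Nonempty then S.map e else Finset.univ.map e
  let l : Finset Y → ℝ := fun S => if S.Nonempty then ε else -ε
  have h1 : ∀ w : Fin n → X, (if HasTail G ρ ε e w then prefixProb G ρ n w else 0) ≤
      ∑ S : Finset Y,
        if n * (ε ^ 2 / 4) < l S * deviation G ρ (T S) w then prefixProb G ρ n w else 0 := by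
    intro w
    have hp := prefixProb_nonneg G hρ n w
    have hnn : ∀ S ∈ (Finset.univ : Finset (Finset Y)),
        0 ≤ if n * (ε ^ 2 / 4) < l S * deviation G ρ (T S) w then prefixProb G ρ n w else 0 := by
      intro S _; split_ifs <;> simp [hp]
    split_ifs with h
    · rcases h with ⟨S, hS, h⟩ | h
      · refine le_trans ?_ (Finset.single_le_sum hnn (Finset.mem_univ S))
        simp [T, l, hS, h]
      · refine le_trans ?_ (Finset.single_le_sum hnn (Finset.mem_univ ∅))
        rw [if_pos (by simpa [T, l] using h)]
    · exact Finset.sum_nonneg hnn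
  refine (Finset.sum_le_sum fun w _ => h1 w).trans ?_
  rw [Finset.sum_comm]
  calc _ ≤ ∑ _S : Finset Y, Real.exp (-(n * ε ^ 2 / 8)) :=
        Finset.sum_le_sum fun S _ => sum_deviation_tail_le G hρ (T S) (by
          simp only [l]; split_ifs <;> simp)
    _ = _ := by simp

-- Counts of outcomes from the summand `Y` are `|s|` times frequencies, and their summed conditional
-- probabilities are `qn` times the statistics of the average state. Absence of tails therefore
-- supplies the hypotheses of `varDist_le_of_deviation`.
open Classical in
theorem varDist_freq_le {Y : Type*} [Fintype Y] (hρ : IsDensity ρ) (hn : 0 < n) {ε q : ℝ}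
    (hε : 0 < ε) (hq : 0 < q) (e : Y ↪ X) (F : POVM Y ι)
    (hG : ∀ y, G.op (e y) = (q : ℂ) • F.op y) {w : Fin n → X} (hw : 0 < prefixProb G ρ n w)
    (htail : ¬ HasTail G ρ ε e w) {s : Finset (Fin n)} {z : {i // i ∈ s} → Y}
    (hz : ∀ i (h : i ∈ s), w i = e (z ⟨i, h⟩)) (hz' : ∀ i, i ∉ s → ∀ y, w i ≠ e y)
    {Q₀ : Y → ℝ} (hQ : IsProb (freq Q₀ z)) :
    varDist (freq Q₀ z) (F.meas (avgState G ρ w)) ≤ ε / q := by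
  have hden : IsDensity (avgState G ρ w) :=
    avgState_mem G hρ hn hw convex_isDensity fun k hk => siteState_isDensity G hρ hk
  have hm := F.isProb_meas hden
  set N : ℝ := (Fintype.card {i // i ∈ s} : ℝ) with hN
  have hcount : ∀ S : Finset Y, (∑ k : Fin n, if w k ∈ S.map e then (1 : ℝ) else 0) =
      ∑ y ∈ S, N * freq Q₀ z y := by
    intro S
    simp only [hN, card_mul_freq]
    rw [← Finset.sum_subset (Finset.subset_univ s) (fun i _ hi => by
      rw [if_neg]
      rw [Finset.mem_map]
      rintro ⟨y, _, hy⟩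
      exact hz' i hi y hy.symm), ← Finset.sum_coe_sort s]
    have h1 : ∀ i : s, (if w i ∈ S.map e then (1 : ℝ) else 0) =
        ∑ y ∈ S, if z i = y then 1 else 0 := by
      intro i
      rw [hz i i.2]
      simp
    simp only [h1]
    rw [Finset.sum_comm]
    exact Finset.sum_congr rfl fun y _ => by simp
  have hdev : ∀ S : Finset Y, deviation G ρ (S.map e) w =
      ∑ y ∈ S, N * freq Q₀ z y - q * n * ∑ y ∈ S, F.meas (avgState G ρ w) y := by
    intro S
    rw [deviation, Finset.sum_sub_distrib, hcount]
    congr 1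
    rw [Finset.sum_comm, Finset.sum_map, mul_assoc, Finset.mul_sum, Finset.mul_sum]
    refine Finset.sum_congr rfl fun y _ => ?_
    rw [meas_avgState G F hn, Finset.mul_sum]
    refine Finset.sum_congr rfl fun k _ => ?_
    rw [POVM.meas, hG, Matrix.smul_mul, Matrix.trace_smul, smul_eq_mul, Complex.re_ofReal_mul]
    rfl
  simp only [HasTail, not_or, not_exists, not_and, not_lt] at htail
  refine varDist_le_of_deviation hQ hm hq hε (Nat.cast_pos.mpr hn) (fun y => rfl)
    (N := N) (fun S hS => ?_) ?_
  · rw [← hdev]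
    have := htail.1 S hS
    refine le_of_mul_le_mul_left ?_ hε
    linarith
  · have := htail.2
    rw [hdev, ← Finset.mul_sum, hQ.2, hm.2] at this
    refine le_of_mul_le_mul_left ?_ hε
    linarith

end Sequential

/-! ### Projections from an orthonormal basis -/

section Orthogonal

variable {n : ℕ} {ι Z' : Type*} [Fintype ι] [DecidableEq ι] [Fintype Z'] {F' : POVM Z' ι}

theorem POVM.IsOrthogonal.card_eq (hF' : F'.IsOrthogonal) : Fintype.card Z' = Fintype.card ι := by
  obtain ⟨b, -⟩ := hF'
  rw [← finrank_euclideanSpace (𝕜 := ℂ) (ι := ι), Module.finrank_eq_card_basis b.toBasis]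

-- The columns of `V` are the product basis vectors labelled by `W`. The isometry gives both that
-- the sum is a projection and that its rank is at most `|W|`.
open Classical in
theorem POVM.IsOrthogonal.sum_prodOp_eq (hF' : F'.IsOrthogonal) (s : Finset (Fin n))
    (W : Finset ({i // i ∈ s} → Z')) :
    ∃ V : Matrix ({i // i ∈ s} → ι) W ℂ, Vᴴ * V = 1 ∧ ∑ w ∈ W, prodOp F' s w = V * Vᴴ := by
  obtain ⟨b, hb⟩ := hF'
  refine ⟨Matrix.of fun x w => ∏ i, b (w.1 i) (x i), ?_, ?_⟩
  · ext w w'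
    simp only [Matrix.mul_apply, Matrix.conjTranspose_apply, Matrix.of_apply, star_prod,
      ← Finset.prod_mul_distrib]
    have h1 : ∑ x : {i // i ∈ s} → ι, ∏ i, star (b (w.1 i) (x i)) * b (w'.1 i) (x i) =
        ∏ i, ∑ j, star (b (w.1 i) j) * b (w'.1 i) j := by
      rw [Finset.prod_univ_sum]; simp
    have h2 : ∀ i, ∑ j, star (b (w.1 i) j) * b (w'.1 i) j =
        if w.1 i = w'.1 i then (1 : ℂ) else 0 := by
      intro i
      rw [← orthonormal_iff_ite.mp b.orthonormal, PiLp.inner_apply]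
      simp [mul_comm]
    rw [h1]
    simp only [h2, Finset.prod_ite_zero, Matrix.one_apply, Subtype.ext_iff, funext_iff]
    simp
  · ext x y
    simp only [Matrix.sum_apply, Matrix.mul_apply, Matrix.conjTranspose_apply, Matrix.of_apply,
      prodOp, hb, Finset.prod_mul_distrib, star_prod]
    exact (Finset.sum_coe_sort W fun w =>
      (∏ i, b (w i) (x i)) * ∏ i, star (b (w i) (y i))).symm

end Orthogonal

/-! ### The virtual joint measurement, its failure probability and the entropy bound -/

section Joint

variable {n : ℕ} {ι Z Z' : Type*} [Fintype ι] [DecidableEq ι] [Fintype Z] [Fintype Z']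

/-- With probability `p` measure `F`, otherwise `F'`. -/
def mixPOVM (F : POVM Z ι) (F' : POVM Z' ι) {p : ℝ} (hp0 : 0 ≤ p) (hp1 : p ≤ 1) :
    POVM (Z ⊕ Z') ι where
  op := Sum.elim (fun z => (p : ℂ) • F.op z) fun z => ((1 - p : ℝ) : ℂ) • F'.op z
  pos := by
    rintro (z | z)
    · exact (F.pos z).smul (by exact_mod_cast hp0)
    · exact (F'.pos z).smul (by exact_mod_cast sub_nonneg.mpr hp1)
  sum_eq := by
    simp only [Fintype.sum_sum_type, Sum.elim_inl, Sum.elim_inr, ← Finset.smul_sum, F.sum_eq,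
      F'.sum_eq, ← add_smul]
    simp

/-- Probability of the outcomes `z` and `w` when the factors in `a` are measured with `F` and
the other ones with `F'`. -/
def jointProb (F : POVM Z ι) (F' : POVM Z' ι) (ρ : Matrix (Fin n → ι) (Fin n → ι) ℂ)
    (a : Finset (Fin n)) (z : {i // i ∈ a} → Z) (w : {i // i ∈ aᶜ} → Z') : ℝ :=
  (embed aᶜ (prodOp F' aᶜ w) * (embed a (prodOp F a z) * ρ)).trace.re

/-- The outcome tuple with `z` on `a` and `w` elsewhere. -/
def glueOutcomes (a : Finset (Fin n)) (z : {i // i ∈ a} → Z) (w : {i // i ∈ aᶜ} → Z') :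
    Fin n → Z ⊕ Z' :=
  fun i => if h : i ∈ a then .inl (z ⟨i, h⟩) else .inr (w ⟨i, Finset.mem_compl.mpr h⟩)

theorem glueOutcomes_injective : Function.Injective
    fun t : (Σ a : Finset (Fin n), ({i // i ∈ a} → Z) × ({i // i ∈ aᶜ} → Z')) =>
      glueOutcomes t.1 t.2.1 t.2.2 := by
  rintro ⟨a, z, w⟩ ⟨a', z', w'⟩ h
  simp only at h
  obtain rfl : a = a' := by
    ext i
    have := congrFun h i
    by_cases h1 : i ∈ a <;> by_cases h2 : i ∈ a' <;> simp [glueOutcomes, h1, h2] at this ⊢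
  congr 2
  · ext i
    simpa [glueOutcomes, i.2] using congrFun h i
  · ext i
    simpa [glueOutcomes, Finset.mem_compl.mp i.2] using congrFun h i

variable (F : POVM Z ι) (F' : POVM Z' ι) {ρ : Matrix (Fin n → ι) (Fin n → ι) ℂ}

theorem jointProb_nonneg (hρ : IsDensity ρ) (a : Finset (Fin n)) (z : {i // i ∈ a} → Z)
    (w : {i // i ∈ aᶜ} → Z') : 0 ≤ jointProb F F' ρ a z w := by
  rw [jointProb, ← Matrix.mul_assoc]
  exact (Complex.nonneg_iff.mp (trace_mul_nonneg (embed_mul_embed_posSemidef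
    disjoint_compl_left (prodOp_posSemidef F' _ _) (prodOp_posSemidef F _ _)) hρ.1)).1

theorem selProb_mul_jointProb {p : ℝ} (hp0 : 0 ≤ p) (hp1 : p ≤ 1) (a : Finset (Fin n))
    (z : {i // i ∈ a} → Z) (w : {i // i ∈ aᶜ} → Z') :
    selProb p a * jointProb F F' ρ a z w =
      prefixProb (mixPOVM F F' hp0 hp1) ρ n (glueOutcomes a z w) := by
  have h : (tens (prefixFactor (mixPOVM F F' hp0 hp1) n (glueOutcomes a z w))) =
      ((selProb p a : ℝ) : ℂ) • (embed aᶜ (prodOp F' aᶜ w) * embed a (prodOp F a z)) := by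
    rw [prodOp_eq_tens, prodOp_eq_tens, embed_tens, embed_tens, tens_mul, selProb,
      Complex.ofReal_prod, ← tens_smul]
    congr 1
    ext1 i
    by_cases hi : i ∈ a <;> simp [prefixFactor, mixPOVM, glueOutcomes, hi]
  rw [prefixProb, h, Matrix.smul_mul, Matrix.trace_smul, smul_eq_mul, Complex.re_ofReal_mul,
    jointProb, Matrix.mul_assoc]

theorem selProb_nonneg {p : ℝ} (hp0 : 0 ≤ p) (hp1 : p ≤ 1) (a : Finset (Fin n)) :
    0 ≤ selProb p a :=
  Finset.prod_nonneg fun i _ => by split_ifs <;> linarith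

theorem sum_selProb (p : ℝ) : ∑ a : Finset (Fin n), selProb p a = 1 := by
  have h : ∀ a : Finset (Fin n), selProb p a =
      p ^ a.card * (1 - p) ^ (Fintype.card (Fin n) - a.card) := by
    intro a
    rw [selProb, ← Finset.prod_mul_prod_compl a, ← Finset.card_compl]
    congr 1
    · rw [← Finset.prod_const]
      exact Finset.prod_congr rfl fun i hi => if_pos hi
    · rw [← Finset.prod_const]
      exact Finset.prod_congr rfl fun i hi => if_neg (Finset.mem_compl.mp hi)
  simp only [h, Fintype.sum_pow_mul_eq_add_pow]
  simp

theorem outcomeProb_nonneg (hρ : IsDensity ρ) (a : Finset (Fin n)) (z : {i // i ∈ a} → Z) :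
    0 ≤ outcomeProb F ρ a z :=
  (Complex.nonneg_iff.mp
    (trace_mul_nonneg (embed_posSemidef (prodOp_posSemidef F a z)) hρ.1)).1

theorem sum_outcomeProb (hρ : IsDensity ρ) (a : Finset (Fin n)) :
    ∑ z, outcomeProb F ρ a z = 1 := by
  simp only [outcomeProb]
  rw [← Complex.re_sum, ← Matrix.trace_sum, ← Matrix.sum_mul, ← embed_sum, sum_prodOp, embed_one,
    Matrix.one_mul, hρ.2, Complex.one_re]

open Classical in
/-- Outcome sequences whose frequency distributions are compatible with `Q`. -/
def typicalSet (F : POVM Z ι) (F' : POVM Z' ι) (ρ : Matrix (Fin n → ι) (Fin n → ι) ℂ) (p ε : ℝ)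
    (Q : Z → ℝ) (a : Finset (Fin n)) : Finset ({i // i ∈ aᶜ} → Z') :=
  {w | aᶜ = ∅ ∨ freq 0 w ∈ compatible F F' (densityRange ρ) p ε Q}

open Classical in
/-- Probability that the outcomes on the complement of `a` are not compatible with `Q`, given that
the frequency distribution observed on `a` is `Q`. -/
def failProb (F : POVM Z ι) (F' : POVM Z' ι) (ρ : Matrix (Fin n → ι) (Fin n → ι) ℂ) (Q₀ : Z → ℝ)
    (p ε : ℝ) (Q : Z → ℝ) (a : Finset (Fin n)) : ℝ :=
  ∑ w ∈ (typicalSet F F' ρ p ε Q a)ᶜ, (prodOp F' aᶜ w * condState F ρ Q₀ Q a).trace.re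

-- Contrapositive: without tails in either summand, the same average state lies in the density range
-- and matches both frequency distributions, which is membership in `compatible`.
open Classical in
theorem glueOutcomes_hasTail (hρ : IsDensity ρ) {p ε : ℝ} (hp0 : 0 < p) (hp1 : p < 1) (hε : 0 < ε)
    {Q₀ : Z → ℝ} (hQ₀ : IsProb Q₀) (a : Finset (Fin n)) (z : {i // i ∈ a} → Z)
    {w : {i // i ∈ aᶜ} → Z'} (hw : w ∉ typicalSet F F' ρ p ε (freq Q₀ z) a)
    (hpos : 0 < prefixProb (mixPOVM F F' hp0.le hp1.le) ρ n (glueOutcomes a z w)) :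
    HasTail (mixPOVM F F' hp0.le hp1.le) ρ ε .inl (glueOutcomes a z w) ∨
      HasTail (mixPOVM F F' hp0.le hp1.le) ρ ε .inr (glueOutcomes a z w) := by
  by_contra hcon
  rw [not_or] at hcon
  simp only [typicalSet, Finset.mem_filter, Finset.mem_univ, true_and, not_or] at hw
  obtain ⟨hne, hw⟩ := hw
  have hn : 0 < n := by
    obtain ⟨i, -⟩ := Finset.nonempty_iff_ne_empty.mpr hne
    exact i.pos
  set G := mixPOVM F F' hp0.le hp1.le
  have hden : IsDensity (avgState G ρ (glueOutcomes a z w)) :=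
    avgState_mem G hρ hn hpos convex_isDensity fun k hk => siteState_isDensity G hρ hk
  have hmem : avgState G ρ (glueOutcomes a z w) ∈ densityRange ρ :=
    avgState_mem G hρ hn hpos (convex_convexHull ℝ _)
      fun k hk => siteState_mem_densityRange G hρ hk
  have hf : IsProb (freq Q₀ z) := isProb_freq z fun _ => hQ₀
  have hf' : IsProb (freq 0 w) := isProb_freq w fun h =>
    absurd (Finset.card_eq_zero.mp ((Fintype.card_coe aᶜ).symm.trans h)) hne
  have h1 := varDist_freq_le G hρ hn hε hp0 .inl F (fun y => rfl) hpos hcon.1 (s := a) (z := z)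
    (fun i h => by simp [glueOutcomes, h]) (fun i h y => by simp [glueOutcomes, h]) hf
  have h2 := varDist_freq_le G hρ hn hε (sub_pos.mpr hp1) .inr F' (fun y => rfl) hpos hcon.2
    (s := aᶜ) (z := w) (fun i h => by simp [glueOutcomes, Finset.mem_compl.mp h])
    (fun i h y => by simp [glueOutcomes, Finset.notMem_compl.mp h]) hf'
  refine hw ⟨hf', _, ⟨_, ⟨hmem, hden, F.isProb_meas hden, _, rfl, h1⟩, rfl⟩, ?_⟩
  rwa [varDist_comm]

open Classical in
theorem sum_jointProb_compl_le (hρ : IsDensity ρ) (hF' : F'.IsOrthogonal) {p ε : ℝ} (hp0 : 0 < p)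
    (hp1 : p < 1) (hε : 0 < ε) {Q₀ : Z → ℝ} (hQ₀ : IsProb Q₀) :
    ∑ a : Finset (Fin n), selProb p a * ∑ z : {i // i ∈ a} → Z,
      ∑ w ∈ (typicalSet F F' ρ p ε (freq Q₀ z) a)ᶜ, jointProb F F' ρ a z w ≤
      2 ^ (Fintype.card ι + Fintype.card Z) * Real.exp (-(n * ε ^ 2 / 8)) := by
  -- For `n = 0` every tuple is typical. The case is separate because `ι` is known to be nonempty
  -- only when `n > 0`.
  rcases Nat.eq_zero_or_pos n with rfl | hn
  · have : ∀ (Q : Z → ℝ) (a : Finset (Fin 0)), typicalSet F F' ρ p ε Q a = Finset.univ := by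
      intro Q a
      have : aᶜ = ∅ := Finset.eq_empty_of_isEmpty _
      simp [typicalSet, this]
    simp only [this, Finset.compl_univ, Finset.sum_empty, Finset.sum_const_zero, mul_zero]
    positivity
  set G := mixPOVM F F' hp0.le hp1.le with hG
  let h : (Fin n → Z ⊕ Z') → ℝ := fun w =>
    (if HasTail G ρ ε .inl w then prefixProb G ρ n w else 0) +
      (if HasTail G ρ ε .inr w then prefixProb G ρ n w else 0)
  have hh : ∀ w, 0 ≤ h w := fun w => by
    have := prefixProb_nonneg G hρ n w
    simp only [h]
    split_ifs <;> positivity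
  have hterm : ∀ (a : Finset (Fin n)) (z : {i // i ∈ a} → Z),
      ∀ w ∈ (typicalSet F F' ρ p ε (freq Q₀ z) a)ᶜ,
        selProb p a * jointProb F F' ρ a z w ≤ h (glueOutcomes a z w) := by
    intro a z w hw
    rw [selProb_mul_jointProb F F' hp0.le hp1.le]
    have hp := prefixProb_nonneg G hρ n (glueOutcomes a z w)
    rcases hp.eq_or_lt with h0 | h0
    · rw [← hG, ← h0]; exact hh _
    · rcases glueOutcomes_hasTail F F' hρ hp0 hp1 hε hQ₀ a z (Finset.mem_compl.mp hw) h0 with ht | ht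
      · simp only [h]
        rw [if_pos ht]
        split_ifs <;> linarith
      · simp only [h]
        rw [if_pos ht]
        split_ifs <;> linarith
  have hdom : ∑ w, h w ≤
      (2 ^ Fintype.card Z + 2 ^ Fintype.card Z') * Real.exp (-(n * ε ^ 2 / 8)) := by
    rw [Finset.sum_add_distrib, add_mul]
    exact add_le_add (sum_hasTail_le G hρ ε .inl) (sum_hasTail_le G hρ ε .inr)
  have hι : Nonempty ι := by
    by_contra hcon
    rw [not_nonempty_iff] at hcon
    have : IsEmpty (Fin n → ι) := ⟨fun f => hcon.false (f ⟨0, hn⟩)⟩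
    simpa [Matrix.trace] using hρ.2
  have hZ : Nonempty Z := by
    by_contra hcon
    rw [not_nonempty_iff] at hcon
    simpa using hQ₀.2
  calc _ ≤ ∑ a : Finset (Fin n), ∑ z : {i // i ∈ a} → Z, ∑ w : {i // i ∈ aᶜ} → Z',
        h (glueOutcomes a z w) := by
        refine Finset.sum_le_sum fun a _ => ?_
        rw [Finset.mul_sum]
        refine Finset.sum_le_sum fun z _ => ?_
        rw [Finset.mul_sum]
        exact (Finset.sum_le_sum (hterm a z)).trans
          (Finset.sum_le_univ_sum_of_nonneg fun w => hh _)
    _ = ∑ t : (Σ a : Finset (Fin n), ({i // i ∈ a} → Z) × ({i // i ∈ aᶜ} → Z')),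
        h (glueOutcomes t.1 t.2.1 t.2.2) := by
        simp only [Fintype.sum_sigma, Fintype.sum_prod_type]
    _ = ∑ w ∈ Finset.univ.map ⟨_, glueOutcomes_injective (n := n) (Z := Z) (Z' := Z')⟩, h w := by
        rw [Finset.sum_map]; rfl
    _ ≤ ∑ w, h w := Finset.sum_le_univ_sum_of_nonneg hh
    _ ≤ _ := hdom
    _ ≤ _ := by
        rw [hF'.card_eq]
        gcongr
        rw [pow_add]
        -- Two numbers that are at least `2` satisfy `x + y ≤ xy`, which merges the two union bounds
        -- into one power.
        have h1 : (2 : ℝ) ≤ 2 ^ Fintype.card ι := le_self_pow₀ (by norm_num) Fintype.card_ne_zero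
        have h2 : (2 : ℝ) ≤ 2 ^ Fintype.card Z := le_self_pow₀ (by norm_num) Fintype.card_ne_zero
        nlinarith

open Classical in
theorem failProb_eq (Q₀ : Z → ℝ) (p ε : ℝ) (Q : Z → ℝ) (a : Finset (Fin n)) :
    failProb F F' ρ Q₀ p ε Q a = (freqProb F ρ Q₀ Q a)⁻¹ * ∑ z : {i // i ∈ a} → Z,
      if freq Q₀ z = Q then ∑ w ∈ (typicalSet F F' ρ p ε Q a)ᶜ, jointProb F F' ρ a z w else 0 := by
  have h : ∀ w, (prodOp F' aᶜ w * condState F ρ Q₀ Q a).trace.re =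
      (freqProb F ρ Q₀ Q a)⁻¹ * ∑ z : {i // i ∈ a} → Z,
        if freq Q₀ z = Q then jointProb F F' ρ a z w else 0 := by
    intro w
    rw [condState, Matrix.mul_smul, Matrix.trace_smul, Complex.real_smul, Complex.re_ofReal_mul,
      Matrix.mul_sum, Matrix.trace_sum, Complex.re_sum]
    congr 1
    refine Finset.sum_congr rfl fun z _ => ?_
    split_ifs
    · rw [trace_mul_reduce, jointProb]
    · simp
  simp only [failProb, h]
  rw [← Finset.mul_sum, Finset.sum_comm]
  congr 1
  refine Finset.sum_congr rfl fun z _ => ?_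
  split_ifs <;> simp

theorem failProb_nonneg (hρ : IsDensity ρ) (Q₀ : Z → ℝ) (p ε : ℝ) (Q : Z → ℝ)
    (a : Finset (Fin n)) : 0 ≤ failProb F F' ρ Q₀ p ε Q a := by
  classical
  rw [failProb_eq]
  refine mul_nonneg (inv_nonneg.mpr (Finset.sum_nonneg fun z _ => ?_))
    (Finset.sum_nonneg fun z _ => ?_)
  · split_ifs
    exacts [outcomeProb_nonneg F hρ a z, le_rfl]
  · split_ifs
    exacts [Finset.sum_nonneg fun w _ => jointProb_nonneg F F' hρ a z w, le_rfl]

-- Averaging over the observed frequency cancels the normalization in `failProb_eq`. Only `c⁻¹ c ≤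
-- 1` is used, so frequencies of probability zero need no care.
open Classical in
theorem sum_outcomeProb_mul_failProb_le (hρ : IsDensity ρ) (Q₀ : Z → ℝ) (p ε : ℝ)
    (a : Finset (Fin n)) :
    ∑ z : {i // i ∈ a} → Z, outcomeProb F ρ a z * failProb F F' ρ Q₀ p ε (freq Q₀ z) a ≤
      ∑ z : {i // i ∈ a} → Z,
        ∑ w ∈ (typicalSet F F' ρ p ε (freq Q₀ z) a)ᶜ, jointProb F F' ρ a z w := by
  set J : ({i // i ∈ a} → Z) → ℝ := fun z =>
    ∑ w ∈ (typicalSet F F' ρ p ε (freq Q₀ z) a)ᶜ, jointProb F F' ρ a z w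
  have hJ : ∀ z, 0 ≤ J z := fun z => Finset.sum_nonneg fun w _ => jointProb_nonneg F F' hρ a z w
  calc _ = ∑ z : {i // i ∈ a} → Z, ∑ z' : {i // i ∈ a} → Z,
        J z' * ((freqProb F ρ Q₀ (freq Q₀ z') a)⁻¹ *
          if freq Q₀ z = freq Q₀ z' then outcomeProb F ρ a z else 0) := by
        refine Finset.sum_congr rfl fun z _ => ?_
        rw [failProb_eq, ← mul_assoc, Finset.mul_sum]
        refine Finset.sum_congr rfl fun z' _ => ?_
        by_cases h : freq Q₀ z' = freq Q₀ z
        · simp only [J, h, if_true]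
          ring
        · rw [if_neg h, if_neg (Ne.symm h)]
          simp
    _ = ∑ z', J z' * ((freqProb F ρ Q₀ (freq Q₀ z') a)⁻¹ * freqProb F ρ Q₀ (freq Q₀ z') a) := by
        rw [Finset.sum_comm]
        refine Finset.sum_congr rfl fun z' _ => ?_
        rw [← Finset.mul_sum, ← Finset.mul_sum, freqProb]
    _ ≤ _ := Finset.sum_le_sum fun z' _ => mul_le_of_le_one_right (hJ z') inv_mul_le_one

theorem expect_sqrt_failProb_le (hρ : IsDensity ρ) (hF' : F'.IsOrthogonal) {p ε : ℝ} (hp0 : 0 < p)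
    (hp1 : p < 1) (hε : 0 < ε) {Q₀ : Z → ℝ} (hQ₀ : IsProb Q₀) :
    expect F ρ Q₀ p (fun Q a => √(failProb F F' ρ Q₀ p ε Q a)) ≤
      (2 : ℝ) ^ (((Fintype.card ι : ℝ) + (Fintype.card Z : ℝ)) / 2) *
        Real.exp (-((n : ℝ) * ε ^ 2 / 16)) := by
  classical
  have hsum := sum_jointProb_compl_le F F' hρ hF' hp0 hp1 hε hQ₀
  -- Jensen over the joint law of selection and outcomes: the mean of the square roots is at most
  -- the root of the mean failure probability.
  have hJ := Real.strictConcaveOn_sqrt.concaveOn.le_map_sum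
    (t := (Finset.univ : Finset (Σ a : Finset (Fin n), {i // i ∈ a} → Z)))
    (w := fun t => selProb p t.1 * outcomeProb F ρ t.1 t.2)
    (p := fun t => failProb F F' ρ Q₀ p ε (freq Q₀ t.2) t.1)
    (fun t _ => mul_nonneg (selProb_nonneg hp0.le hp1.le _) (outcomeProb_nonneg F hρ _ _))
    (by simp only [Fintype.sum_sigma, ← Finset.mul_sum, sum_outcomeProb F hρ, mul_one, sum_selProb])
    (fun t _ => failProb_nonneg F F' hρ _ _ _ _ _)
  simp only [Fintype.sum_sigma, smul_eq_mul, mul_assoc, ← Finset.mul_sum] at hJ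
  have h1 : ∑ a : Finset (Fin n), selProb p a * ∑ z : {i // i ∈ a} → Z,
      outcomeProb F ρ a z * failProb F F' ρ Q₀ p ε (freq Q₀ z) a ≤
      2 ^ (Fintype.card ι + Fintype.card Z) * Real.exp (-(n * ε ^ 2 / 8)) :=
    (Finset.sum_le_sum fun a _ => mul_le_mul_of_nonneg_left
      (sum_outcomeProb_mul_failProb_le F F' hρ Q₀ p ε a)
      (selProb_nonneg hp0.le hp1.le a)).trans hsum
  have h2 : ((2 : ℝ) ^ (((Fintype.card ι : ℝ) + (Fintype.card Z : ℝ)) / 2) *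
        Real.exp (-((n : ℝ) * ε ^ 2 / 16))) ^ 2 =
      2 ^ (Fintype.card ι + Fintype.card Z) * Real.exp (-(n * ε ^ 2 / 8)) := by
    rw [mul_pow, ← Real.rpow_natCast (2 ^ _) 2, ← Real.rpow_mul (by norm_num), ← Real.exp_nat_mul,
      ← Real.rpow_natCast 2]
    congr 2
    · push_cast; ring
    · push_cast; ring
  refine (le_of_eq ?_).trans (hJ.trans (Real.sqrt_le_iff.mpr ⟨by positivity, h1.trans h2.ge⟩))
  rfl

theorem condState_isDensity (hρ : IsDensity ρ) {Q₀ Q : Z → ℝ} {a : Finset (Fin n)}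
    (h : 0 < freqProb F ρ Q₀ Q a) : IsDensity (condState F ρ Q₀ Q a) := by
  classical
  constructor
  · refine PosSemidef.smul (posSemidef_sum _ fun z _ => ?_) (inv_pos.mpr h).le
    split_ifs
    exacts [reduce_embed_mul_posSemidef disjoint_compl_right hρ.1 (prodOp_posSemidef F a z), .zero]
  · have : (∑ z : {i // i ∈ a} → Z,
        if freq Q₀ z = Q then reduce aᶜ (embed a (prodOp F a z) * ρ) else 0).trace =
        ((freqProb F ρ Q₀ Q a : ℝ) : ℂ) := by
      rw [freqProb, Complex.ofReal_sum, Matrix.trace_sum]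
      refine Finset.sum_congr rfl fun z _ => ?_
      split_ifs
      · rw [trace_reduce, outcomeProb, ofReal_re_of_nonneg
          (trace_mul_nonneg (embed_posSemidef (prodOp_posSemidef F a z)) hρ.1)]
      · simp
    have h0 : ((freqProb F ρ Q₀ Q a : ℝ) : ℂ) ≠ 0 := by exact_mod_cast h.ne'
    rw [condState, Matrix.trace_smul, this, Complex.real_smul, Complex.ofReal_inv,
      inv_mul_cancel₀ h0]

theorem logb_card_typicalSet_le {p ε : ℝ} (Q : Z → ℝ) (a : Finset (Fin n))
    (hne : (typicalSet F F' ρ p ε Q a).Nonempty) :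
    Real.logb 2 (typicalSet F F' ρ p ε Q a).card ≤
      ((aᶜ).card : ℝ) * shannonMax (compatible F F' (densityRange ρ) p ε Q) := by
  classical
  -- An empty complement has one virtual tuple and no meaningful type, so both sides are `0`.
  by_cases ha : aᶜ = ∅
  · have : IsEmpty {i // i ∈ aᶜ} := by rw [ha]; infer_instance
    have hc : (typicalSet F F' ρ p ε Q a).card ≤ 1 := Finset.card_le_one_of_subsingleton _
    have : (typicalSet F F' ρ p ε Q a).card = 1 := le_antisymm hc hne.card_pos
    simp [this, ha]
  · have := logb_card_le_of_freq_mem (B := compatible F F' (densityRange ρ) p ε Q)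
      (fun P hP => hP.1) (convex_compatible F F' (convex_convexHull ℝ _) p ε Q) 0
      (typicalSet F F' ρ p ε Q a) (fun w hw => by simpa [typicalSet, ha] using hw) hne
    rwa [Fintype.card_coe] at this

theorem smoothS0_condState_le (hρ : IsDensity ρ) (hF' : F'.IsOrthogonal) {p ε : ℝ} {Q₀ Q : Z → ℝ}
    {a : Finset (Fin n)} (h : 0 < freqProb F ρ Q₀ Q a) :
    smoothS0 √(failProb F F' ρ Q₀ p ε Q a) (condState F ρ Q₀ Q a) ≤
      ((aᶜ).card : ℝ) * shannonMax (compatible F F' (densityRange ρ) p ε Q) := by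
  classical
  have hσ := condState_isDensity F hρ h
  set σ := condState F ρ Q₀ Q a
  set W := typicalSet F F' ρ p ε Q a with hW
  obtain ⟨V, hV, hP⟩ := hF'.sum_prodOp_eq aᶜ W
  set P := ∑ w ∈ W, prodOp F' aᶜ w with hPdef
  have hfail : failProb F F' ρ Q₀ p ε Q a = 1 - (P * σ).trace.re := by
    have h1 : ∑ w, (prodOp F' aᶜ w * σ).trace.re = 1 := by
      rw [← Complex.re_sum, ← Matrix.trace_sum, ← Matrix.sum_mul, sum_prodOp, Matrix.one_mul, hσ.2,
        Complex.one_re]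
    rw [← Finset.sum_add_sum_compl W] at h1
    rw [failProb, hPdef, Matrix.sum_mul, Matrix.trace_sum, Complex.re_sum]
    linarith
  have hmax : 0 ≤ ((aᶜ).card : ℝ) * shannonMax (compatible F F' (densityRange ρ) p ε Q) :=
    mul_nonneg (Nat.cast_nonneg _) (shannonMax_nonneg fun P hP => hP.1)
  have hlog : ∀ {r m : ℕ} {b : ℝ}, r ≤ m → 0 ≤ b → (0 < m → Real.logb 2 m ≤ b) →
      Real.logb 2 r ≤ b := by
    intro r m b hrm hb hm
    rcases Nat.eq_zero_or_pos r with rfl | hr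
    · simpa using hb
    · refine le_trans ?_ (hm (hr.trans_le hrm))
      exact Real.logb_le_logb_of_le (by norm_num) (by exact_mod_cast hr) (by exact_mod_cast hrm)
  -- If the projection has no weight, the failure probability is at least `1`; the smoothing radius
  -- then covers all density operators and a rank-one state serves.
  rcases le_or_gt (P * σ).trace.re 0 with ht | ht
  · have hne : Nonempty ({i // i ∈ aᶜ} → ι) := by
      by_contra hcon
      rw [not_nonempty_iff] at hcon
      simpa [Matrix.trace] using hσ.2
    obtain ⟨τ, hτ, hr⟩ := exists_isDensity_rank_le_one hne
    refine smoothS0_le hτ ((traceDist_le_one hσ hτ).trans ?_) (hlog hr hmax (by simpa using hmax))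
    rw [hfail, Real.one_le_sqrt]
    linarith
  · obtain ⟨τ, hτ, hr, hd⟩ := gentle_measurement hσ (hP ▸ isHermitian_mul_conjTranspose_self V)
      (by rw [hP, Matrix.mul_assoc, ← Matrix.mul_assoc Vᴴ, hV, Matrix.one_mul]) ht
    refine smoothS0_le hτ (hfail ▸ hd) (hlog (m := W.card) (hr.trans ?_) hmax fun hpos =>
      logb_card_typicalSet_le F F' Q a (Finset.card_pos.mp hpos))
    rw [hP]
    exact (Matrix.rank_mul_le_left _ _).trans ((Matrix.rank_le_card_width V).trans (by simp))

end Joint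

end QuantEntr

end

theorem mainTheorem2 {n : ℕ} {ι Z Z' : Type*} [Fintype ι] [DecidableEq ι]
    [Fintype Z] [Fintype Z']
    (ρ : Matrix (Fin n → ι) (Fin n → ι) ℂ) (hρ : QuantEntr.IsDensity ρ)
    (F : QuantEntr.POVM Z ι) (F' : QuantEntr.POVM Z' ι) (hF' : F'.IsOrthogonal)
    (Q₀ : Z → ℝ) (hQ₀ : QuantEntr.IsProb Q₀)
    (p : ℝ) (hp0 : 0 < p) (hp1 : p < 1) (ε : ℝ) (hε : 0 < ε) :
    ∃ μ : (Z → ℝ) → Finset (Fin n) → ℝ,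
      (∀ Q a, 0 ≤ μ Q a) ∧
      QuantEntr.expect F ρ Q₀ p μ ≤
        (2 : ℝ) ^ (((Fintype.card ι : ℝ) + (Fintype.card Z : ℝ)) / 2) *
          Real.exp (-((n : ℝ) * ε ^ 2 / 16)) ∧
      ∀ (Q : Z → ℝ) (a : Finset (Fin n)), QuantEntr.IsProb Q →
        0 < QuantEntr.freqProb F ρ Q₀ Q a →
        QuantEntr.smoothS0 (μ Q a) (QuantEntr.condState F ρ Q₀ Q a) ≤
          ((aᶜ).card : ℝ) * QuantEntr.shannonMax
              (QuantEntr.compatible F F' (QuantEntr.densityRange ρ) p ε Q) +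
            Real.logb 2 ((aᶜ).card : ℝ) * ((Fintype.card ι : ℝ) - 1) := by
  refine ⟨fun Q a => √(QuantEntr.failProb F F' ρ Q₀ p ε Q a), fun Q a => Real.sqrt_nonneg _,
    QuantEntr.expect_sqrt_failProb_le F F' hρ hF' hp0 hp1 hε hQ₀, fun Q a _ h => ?_⟩
  -- The entropy term already suffices; what remains is that `log |ā| (dim - 1)` is nonnegative,
  -- with `log 0 = 0` when the complement is empty.
  refine le_add_of_le_of_nonneg (QuantEntr.smoothS0_condState_le F F' hρ hF' h) ?_
  rcases Finset.eq_empty_or_nonempty aᶜ with ha | ⟨i, hi⟩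
  · simp [ha]
  · have hι : Nonempty ι := by
      by_contra hcon
      rw [not_nonempty_iff] at hcon
      have : IsEmpty (Fin n → ι) := ⟨fun f => hcon.false (f i)⟩
      simpa [Matrix.trace] using hρ.2
    have h1 : (1 : ℝ) ≤ Fintype.card ι := by exact_mod_cast Fintype.card_pos
    have h2 : (1 : ℝ) ≤ (aᶜ).card := by exact_mod_cast Finset.card_pos.mpr ⟨i, hi⟩
    exact mul_nonneg (Real.logb_nonneg (by norm_num) h2) (by linarith)
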